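/- \textbf{Proposition (Linearity of $\mathcal{P}_{\psi,g}$).} Let $g\in C^1([0,1])$ be strictly increasing with $g(0)=0$, let $\beta\in\mathbb{R}$ and $\psi(\eta)=\beta\eta$. Let $\mathcal{M}_a^{<1}$ be the set of probability measures on $[0,1]$ with finitely many atoms $0\le q_1<\dots<q_k<q_{k+1}=1$ (and no other mass), one of them located at $1$; such a measure is identified with its distribution function $x$, and $x_l:=x(q_l)$, so that $0<x_1<\dots<x_{k+1}=1$. For $x\in\mathcal{M}_a^{<1}$ a GREM($x$) is built as follows. For $0<m<1$, a REM($m$) is a Poisson point process on $(0,\infty)$ with intensity measure $m\,s^{-m-1}ds$, enumerated in decreasing order. For $\alpha=(\alpha_1,\dots,\alpha_k)\in\mathbb{N}^k$ write $\alpha(l)=(\alpha_1,\dots,\alpha_l)$, $0\le l\le k$. Let $\zeta^{\alpha(l-1)}$, $1\le l\le k$, $\alpha(l-1)\in\mathbb{N}^{l-1}$, be independent, $\zeta^{\alpha(l-1)}$ being a REM($x_l$), and put $$\xi_\alpha=\prod_{l=1}^k(\zeta^{\alpha(l-1)})_{\alpha_l},\qquad q_{\alpha,\alpha'}=\max\{q_{l+1}:\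 0\le l\le k,\ \alpha(l)=\alpha'(l)\}.$$ Let $\kappa=(\kappa_\alpha(r),\ \alpha\in\mathbb{N}^k,\ 0\le r\le1)$ be a centered Gaussian process, independent of the processes $\zeta$, with $\mathrm{Cov}(\kappa_\alpha(r),\kappa_{\alpha'}(r'))=g(r\wedge r'\wedge q_{\alpha,\alpha'})$, and define $$\mathcal{P}_{\psi,g}(x)=\mathbb{E}_x\left[\log\frac{\sum_\alpha\xi_\alpha e^{\psi(\kappa_\alpha(1))}}{\sum_\alpha\xi_\alpha}\right].$$ Then, for every $x\in\mathcal{M}_a^{<1}$ and every realization of the GREM($x$) and its field $\kappa$, both sums are almost surely finite, the logarithm is integrable, and $$\mathcal{P}_{\psi,g}(x)=\frac{\beta^2}{2}\int_0^1x(q)\,dg(q),\qquad dg(q)=g'(q)\,dq.$$ In particular $\mathcal{P}_{\psi,g}$ is a bounded linear functional of $x$: there is a continuous linear functional $\Lambda$ on $L^1([0,1],g'(q)dq)$, not depending on $x$, such that $\mathcal{P}_{\psi,g}(x)=\Lambda(x)$ for all $x\in\mathcal{M}_a^{<1}$. -/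

import Mathlib

open MeasureTheory ProbabilityTheory Set
open scoped ENNReal NNReal

noncomputable section

namespace RPC

/-- `M_{a,k}^{<1}`: probability measures on `[0,1]` with exactly `k + 1` atoms (and nothing else),
one of them at `1`. The atoms are listed increasingly: `q 0 < ⋯ < q k = 1`, so that `q l` is the
position of the `(l+1)`-st atom. The listing is determined by the measure. -/
structure AtomicMeasure (k : ℕ) where
  law : Measure ℝ
  isProb : IsProbabilityMeasure law
  q : Fin (k + 1) → ℝ
  q_strictMono : StrictMono q
  q_nonneg : 0 ≤ q 0
  q_last : q (Fin.last k) = 1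
  atom_pos : ∀ l, 0 < law {q l}
  concentrated : law (range q)ᶜ = 0

/-- The distribution function of the measure, `r ↦ x(r)`. -/
def AtomicMeasure.df {k : ℕ} (x : AtomicMeasure k) (r : ℝ) : ℝ := cdf x.law r

/-- The set of admissible covariance functions: `g ∈ C¹([0,1])`, strictly increasing, `g(0) = 0`. -/
structure IsCovFunction (g : ℝ → ℝ) : Prop where
  contDiffOn : ContDiffOn ℝ 1 g (Icc 0 1)
  strictMonoOn : StrictMonoOn g (Icc 0 1)
  map_zero : g 0 = 0

/-- The measure `dg(r) = g'(r) dr` on `[0,1]`. -/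
def dMeasure (g : ℝ → ℝ) : Measure ℝ :=
  (volume.restrict (Icc 0 1)).withDensity fun r => ENNReal.ofReal (derivWithin g (Icc 0 1) r)

section Processes

variable {Ω : Type*} [MeasurableSpace Ω]

/-- A Poisson point process on `E` with intensity `ν`, as a random counting measure: the number of
points in a measurable set of finite intensity is Poisson distributed with mean this intensity, and
the numbers of points in pairwise disjoint measurable sets are independent. -/
structure IsPoissonProcess {E : Type*} [MeasurableSpace E] (N : Ω → Measure E) (ν : Measure E)
    (P : Measure Ω) : Prop where
  hasLaw : ∀ A, MeasurableSet A → ν A ≠ ∞ →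
    HasLaw (fun ω => N ω A)
      ((poissonMeasure (ν A).toNNReal).map (fun n : ℕ => (n : ℝ≥0∞))) P
  indep : ∀ (n : ℕ) (A : Fin n → Set E), (∀ i, MeasurableSet (A i)) →
    Pairwise (fun i j => Disjoint (A i) (A j)) → iIndepFun (fun i ω => N ω (A i)) P

/-- The measure `m s^{-m-1} ds` on `(0,∞)`. -/
def remIntensity (m : ℝ) : Measure ℝ :=
  (volume.restrict (Ioi 0)).withDensity fun s => ENNReal.ofReal (m * s ^ (-m - 1))

/-- `ζ 0 > ζ 1 > ⋯ > 0` is the decreasing enumeration of the points of a REM with parameter `m`,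
that is, of a Poisson point process on `(0,∞)` with intensity `m s^{-m-1} ds`. -/
structure IsREM (m : ℝ) (ζ : ℕ → Ω → ℝ) (P : Measure Ω) : Prop where
  measurable : ∀ j, Measurable (ζ j)
  pos : ∀ᵐ ω ∂P, ∀ j, 0 < ζ j ω
  strictAnti : ∀ᵐ ω ∂P, StrictAnti fun j => ζ j ω
  poisson : IsPoissonProcess (fun ω => Measure.sum fun j => Measure.dirac (ζ j ω))
    (remIntensity m) P

/-- The interior nodes of the cascade: the words `(α_1, …, α_l)` with `0 ≤ l < k`. -/
abbrev Node (k : ℕ) : Type := Σ l : Fin k, (Fin l → ℕ)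

/-- The truncation `α(l) = (α_1, …, α_l)` of `α ∈ ℕ^k`, for `0 ≤ l < k`. -/
def trunc {k : ℕ} (α : Fin k → ℕ) (l : Fin k) : Node k :=
  ⟨l, fun i => α (Fin.castLE l.isLt.le i)⟩

/-- The cascade of a GREM with parameter `x`: to every word of length `l < k` is attached a REM with
parameter `x(q l)` (the value of `x` at its `(l+1)`-st atom), and all these are independent. -/
structure IsCascade {k : ℕ} (x : AtomicMeasure k) (ζ : Node k → ℕ → Ω → ℝ) (P : Measure Ω) :
    Prop where
  isREM : ∀ a : Node k, IsREM (x.df (x.q a.1.castSucc)) (ζ a) P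
  indep : iIndepFun (fun (a : Node k) ω (j : ℕ) => ζ a j ω) P

/-- The points `ξ_α = ∏_{l=1}^k (ζ^{α(l-1)})_{α_l}` of the GREM. -/
def weight {k : ℕ} (ζ : Node k → ℕ → Ω → ℝ) (α : Fin k → ℕ) (ω : Ω) : ℝ :=
  ∏ l : Fin k, ζ (trunc α l) (α l) ω

open Classical in
/-- The levels `0 ≤ l ≤ k` up to which `α` and `α'` agree, i.e. with `α(l) = α'(l)`. -/
def commonLevels {k : ℕ} (α α' : Fin k → ℕ) : Finset (Fin (k + 1)) :=
  Finset.univ.filter fun l => ∀ i : Fin k, (i : ℕ) < l → α i = α' i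

theorem commonLevels_nonempty {k : ℕ} (α α' : Fin k → ℕ) : (commonLevels α α').Nonempty :=
  ⟨0, by simp [commonLevels]⟩

/-- The overlap `q_{α,α'} = max {q_{l+1} : α(l) = α'(l)}`. (The position `q_{l+1}` of the `(l+1)`-st
atom is `x.q l`.) -/
def overlap {k : ℕ} (x : AtomicMeasure k) (α α' : Fin k → ℕ) : ℝ :=
  (commonLevels α α').sup' (commonLevels_nonempty α α') x.q

/-- `κ = (κ_α(r))`, `α ∈ ℕ^k`, `0 ≤ r ≤ 1`, is a centered Gaussian process with
`Cov(κ_α(r), κ_{α'}(r')) = g(r ∧ r' ∧ q_{α,α'})`. -/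
structure IsGaussianField {k : ℕ} (x : AtomicMeasure k) (g : ℝ → ℝ)
    (κ : (Fin k → ℕ) × Icc (0 : ℝ) 1 → Ω → ℝ) (P : Measure Ω) : Prop where
  measurable : ∀ t, Measurable (κ t)
  gaussian : IsGaussianProcess κ P
  centered : ∀ t, ∫ ω, κ t ω ∂P = 0
  cov : ∀ (α α' : Fin k → ℕ) (r r' : Icc (0 : ℝ) 1),
    covariance (κ (α, r)) (κ (α', r')) P = g (min (min (r : ℝ) r') (overlap x α α'))

/-- A GREM with parameter `x` (through its cascade `ζ`) together with a Gaussian field `κ` on it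
with covariance function `g`, the field being independent of the cascade. -/
structure IsGREMWithField {k : ℕ} (x : AtomicMeasure k) (g : ℝ → ℝ) (ζ : Node k → ℕ → Ω → ℝ)
    (κ : (Fin k → ℕ) × Icc (0 : ℝ) 1 → Ω → ℝ) (P : Measure Ω) : Prop where
  cascade : IsCascade x ζ P
  field : IsGaussianField x g κ P
  indep : IndepFun (fun ω a j => ζ a j ω) (fun ω t => κ t ω) P

/-- `∑_α ξ_α`. -/
def total {k : ℕ} (ζ : Node k → ℕ → Ω → ℝ) (ω : Ω) : ℝ := ∑' α, weight ζ α ω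

/-- The point `ξ_α e^{ψ(κ_α(1))}` of the shifted process. -/
def shiftedWeight {k : ℕ} (ψ : ℝ → ℝ) (ζ : Node k → ℕ → Ω → ℝ)
    (κ : (Fin k → ℕ) × Icc (0 : ℝ) 1 → Ω → ℝ) (α : Fin k → ℕ) (ω : Ω) : ℝ :=
  weight ζ α ω * Real.exp (ψ (κ (α, 1) ω))

/-- `log (∑_α ξ_α e^{ψ(κ_α(1))} / ∑_α ξ_α)`. -/
def logRatio {k : ℕ} (ψ : ℝ → ℝ) (ζ : Node k → ℕ → Ω → ℝ)
    (κ : (Fin k → ℕ) × Icc (0 : ℝ) 1 → Ω → ℝ) (ω : Ω) : ℝ :=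
  Real.log ((∑' α, shiftedWeight ψ ζ κ α ω) / total ζ ω)

/-- The functional `𝒫_{ψ,g}(x) = 𝔼_x [log (∑_α ξ_α e^{ψ(κ_α(1))} / ∑_α ξ_α)]`, evaluated on a
realization `(ζ, κ)` of the GREM with parameter `x` and its Gaussian field. -/
def rpcFunctional {k : ℕ} (ψ : ℝ → ℝ) (ζ : Node k → ℕ → Ω → ℝ)
    (κ : (Fin k → ℕ) × Icc (0 : ℝ) 1 → Ω → ℝ) (P : Measure Ω) : ℝ :=
  ∫ ω, logRatio ψ ζ κ ω ∂P

end Processes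

end RPC

end

/-! The GREM is a sum over the leaves of a tree of depth `k`. The field at `1` splits along each
branch into increments, one per node; these are centered, jointly Gaussian and uncorrelated, hence
independent (`ae_eq_sum_increment`, `iIndepFun_increment`). Both sums in the logarithm thus become
recursive tree sums `treeSum`, with inverse temperature `β` and `0` respectively, up to a factor
`exp (β H)` at the root. That factor is common to all leaves and its logarithm has mean zero.

The engine is stability of a REM under independent marks. If `ζ` is a REM with parameter `m` and the
marks `Y_j` are independent of each other and of `ζ`, with a common Laplace transform, then `∑ ζ_j
Y_j` has Laplace transform `exp (-C t^m 𝔼 Y^m)` (`IsREM.lintegral_lap_tsum`): the marks enter only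
through one moment. Inductively, from the leaves to the root, a tree sum has Laplace transform `exp
(-a (λ t)^m)`, where `a` is free of `β` and only the scale `λ` depends on it
(`IsTreeField.treeLaw_succ`). A Gaussian mark of variance `v` multiplies the `m`-th moment by `exp
(v (mβ)^2 / 2)`, hence the scale by `exp (v β^2 m / 2)`. The induction needs moments of order `m_l`
at level `l + 1`, and these are finite because the parameters increase strictly with depth.

So the small positive moments at `β` are `λ^p` times those at `0`. The expected logarithm is the
derivative of `p ↦ 𝔼 X^p` at `p = 0`, so the two expected logarithms differ by `log λ = β^2/2 ∑ m_l
v_{l+1}` (`integral_log_of_moments`, `log_treeScale`). The last sum is the integral of the step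
function `x` against `dg` (`AtomicMeasure.integral_df`), which is visibly linear in `x`. -/

namespace RPC

open Filter Topology

/-! ### The exponential `e^{-x}` on `[0,∞]` -/

/-- The function `x ↦ e^{-x}` on `[0,∞]`, with `e^{-∞} = 0`. -/
noncomputable def lap (x : ℝ≥0∞) : ℝ≥0∞ := (EReal.exp x)⁻¹

@[simp] theorem lap_zero : lap 0 = 1 := by simp [lap]

@[simp] theorem lap_top : lap ∞ = 0 := by simp [lap]

theorem lap_ofReal {r : ℝ} (hr : 0 ≤ r) :
    lap (ENNReal.ofReal r) = ENNReal.ofReal (Real.exp (-r)) := by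
  rw [lap, EReal.coe_ennreal_ofReal, max_eq_left hr, EReal.exp_coe, Real.exp_neg,
    ENNReal.ofReal_inv_of_pos (Real.exp_pos _)]

theorem lap_add (x y : ℝ≥0∞) : lap (x + y) = lap x * lap y := by
  rw [lap, lap, lap, EReal.coe_ennreal_add, EReal.exp_add, ENNReal.mul_inv]
  · left; simp
  · right; simp

theorem continuous_lap : Continuous lap :=
  continuous_inv.comp (ENNReal.logHomeomorph.symm.continuous.comp continuous_coe_ennreal_ereal)

theorem measurable_lap : Measurable lap := continuous_lap.measurable

theorem lap_antitone : Antitone lap := fun x y h => by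
  simpa [lap] using h

theorem lap_le_one (x : ℝ≥0∞) : lap x ≤ 1 := by
  simpa using lap_antitone (zero_le (a := x))

theorem lap_ne_top (x : ℝ≥0∞) : lap x ≠ ∞ := ((lap_le_one x).trans_lt ENNReal.one_lt_top).ne

theorem lap_sum {ι : Type*} (s : Finset ι) (f : ι → ℝ≥0∞) :
    lap (∑ i ∈ s, f i) = ∏ i ∈ s, lap (f i) := by
  classical
  induction s using Finset.induction_on with
  | empty => simp
  | insert a s ha ih => rw [Finset.sum_insert ha, Finset.prod_insert ha, lap_add, ih]

theorem tendsto_prod_lap (f : ℕ → ℝ≥0∞) :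
    Tendsto (fun n => ∏ i ∈ Finset.range n, lap (f i)) atTop (𝓝 (lap (∑' i, f i))) := by
  simp_rw [← lap_sum]
  exact (continuous_lap.tendsto _).comp ENNReal.summable.hasSum.tendsto_sum_nat

/-! ### The REM intensity and its stable integrals -/

theorem measurable_remDensity (m : ℝ) :
    Measurable fun s : ℝ => ENNReal.ofReal (m * s ^ (-m - 1)) := by fun_prop

theorem lintegral_remIntensity (m : ℝ) {f : ℝ → ℝ≥0∞} (hf : Measurable f) :
    ∫⁻ s, f s ∂(remIntensity m) = ∫⁻ s in Ioi 0, ENNReal.ofReal (m * s ^ (-m - 1)) * f s := by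
  rw [remIntensity, lintegral_withDensity_eq_lintegral_mul _ (measurable_remDensity m) hf]
  rfl

instance sigmaFinite_remIntensity (m : ℝ) : SigmaFinite (remIntensity m) :=
  SigmaFinite.withDensity_ofReal _

theorem ae_remIntensity_pos (m : ℝ) : ∀ᵐ s ∂(remIntensity m), 0 < s :=
  (withDensity_absolutelyContinuous _ _).ae_le (ae_restrict_mem measurableSet_Ioi)

/-- Scaling of the intensity of a REM. -/
theorem lintegral_remIntensity_comp_mul {m c : ℝ} (hc : 0 < c) {f : ℝ → ℝ≥0∞}
    (hf : Measurable f) :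
    ∫⁻ s, f (c * s) ∂(remIntensity m) =
      ENNReal.ofReal (c ^ m) * ∫⁻ s, f s ∂(remIntensity m) := by
  rw [lintegral_remIntensity m (by fun_prop), lintegral_remIntensity m hf]
  have himg : (fun s : ℝ => c * s) '' Ioi 0 = Ioi 0 := by
    simpa using image_mul_left_Ioi hc (0 : ℝ)
  conv_rhs => rw [← himg]
  rw [lintegral_image_eq_lintegral_abs_deriv_mul (f' := fun _ => c) measurableSet_Ioi
    (fun x _ => by simpa using ((hasDerivAt_id x).const_mul c).hasDerivWithinAt)
    (fun x _ y _ h => mul_left_cancel₀ hc.ne' h), ← lintegral_const_mul _ (by fun_prop)]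
  refine setLIntegral_congr_fun measurableSet_Ioi fun s hs => ?_
  have hs : 0 < s := hs
  simp only [← mul_assoc]
  congr 1
  rw [← ENNReal.ofReal_mul (by positivity), ← ENNReal.ofReal_mul (by positivity), abs_of_pos hc]
  congr 1
  rw [Real.mul_rpow hc.le hs.le, show -m - 1 = -(m + 1) by ring, Real.rpow_neg hc.le,
    Real.rpow_add hc, Real.rpow_one]
  field_simp

/-- The constant `∫ (1 - e^{-a s^p}) m s^{-m-1} ds`. -/
noncomputable def stableConst (a p m : ℝ) : ℝ≥0∞ :=
  ∫⁻ s, (1 - lap (ENNReal.ofReal (a * s ^ p))) ∂(remIntensity m)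

theorem measurable_one_sub_lap (a p : ℝ) :
    Measurable fun s : ℝ => 1 - lap (ENNReal.ofReal (a * s ^ p)) :=
  measurable_const.sub (measurable_lap.comp (by fun_prop))

theorem one_sub_lap_ofReal_le {r : ℝ} (hr : 0 ≤ r) :
    1 - lap (ENNReal.ofReal r) ≤ ENNReal.ofReal r := by
  rw [lap_ofReal hr, ← ENNReal.ofReal_one, ← ENNReal.ofReal_sub _ (Real.exp_pos _).le]
  apply ENNReal.ofReal_le_ofReal
  linarith [Real.add_one_le_exp (-r)]

/-- The integrand is at most `m a s^(p-m-1)` near `0`, integrable there because `m < p`, and at most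
`m s^(-m-1)` beyond `1`, integrable there because `0 < m`. -/
theorem stableConst_ne_top {a p m : ℝ} (ha : 0 < a) (hm : 0 < m) (hmp : m < p) :
    stableConst a p m ≠ ∞ := by
  rw [stableConst, lintegral_remIntensity m (measurable_one_sub_lap a p), ← lt_top_iff_ne_top,
    ← Ioc_union_Ioi_eq_Ioi zero_le_one]
  refine (lintegral_union_le _ _ _).trans_lt (ENNReal.add_lt_top.2 ⟨?_, ?_⟩)
  · have hint : IntegrableOn (fun s : ℝ => m * a * s ^ (p - m - 1)) (Ioc 0 1) := by
      have := intervalIntegral.intervalIntegrable_rpow' (a := 0) (b := 1) (r := p - m - 1)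
        (by linarith)
      exact ((intervalIntegrable_iff_integrableOn_Ioc_of_le zero_le_one).1 this).const_mul _
    refine lt_of_le_of_lt ?_ hint.lintegral_lt_top
    refine setLIntegral_mono' measurableSet_Ioc fun s hs => ?_
    have hs0 : 0 < s := hs.1
    calc _ ≤ ENNReal.ofReal (m * s ^ (-m - 1)) * ENNReal.ofReal (a * s ^ p) :=
          mul_le_mul_right (one_sub_lap_ofReal_le (by positivity)) _
      _ = _ := by
          rw [← ENNReal.ofReal_mul (by positivity)]
          congr 1
          rw [show p - m - 1 = (-m - 1) + p by ring, Real.rpow_add hs0]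
          ring
  · have hint : IntegrableOn (fun s : ℝ => m * s ^ (-m - 1)) (Ioi 1) :=
      (integrableOn_Ioi_rpow_of_lt (by linarith) zero_lt_one).const_mul _
    refine lt_of_le_of_lt ?_ hint.lintegral_lt_top
    refine lintegral_mono fun s => ?_
    exact (mul_le_mul_right tsub_le_self _).trans_eq (mul_one _)

theorem stableConst_ne_zero {a p m : ℝ} (ha : 0 < a) (hm : 0 < m) : stableConst a p m ≠ 0 := by
  rw [stableConst, lintegral_remIntensity m (measurable_one_sub_lap a p)]
  refine (pos_iff_ne_zero.1 ((setLIntegral_pos_iff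
    ((measurable_remDensity m).mul (measurable_one_sub_lap a p))).2 ?_))
  rw [inter_eq_right.2]
  · simp
  · intro s hs
    have hs : 0 < s := hs
    rw [Function.mem_support]
    refine mul_ne_zero ?_ ?_
    · rw [ENNReal.ofReal_ne_zero_iff]; positivity
    · dsimp only
      rw [lap_ofReal (by positivity), ← ENNReal.ofReal_one,
        ← ENNReal.ofReal_sub _ (Real.exp_pos _).le, ENNReal.ofReal_ne_zero_iff, sub_pos,
        Real.exp_lt_one_iff, neg_lt_zero]
      positivity

/-- `∫ (1 - e^{-sx}) m s^{-m-1} ds = C x^m` for all `x ∈ [0,∞]`. -/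
theorem lintegral_one_sub_lap_mul {m : ℝ} (hm : 0 < m) (x : ℝ≥0∞) :
    ∫⁻ s, (1 - lap (ENNReal.ofReal s * x)) ∂(remIntensity m) = stableConst 1 1 m * x ^ m := by
  have key : ∀ r : ℝ, 0 < r →
      ∫⁻ s, (1 - lap (ENNReal.ofReal s * ENNReal.ofReal r)) ∂(remIntensity m) =
        stableConst 1 1 m * ENNReal.ofReal r ^ m := by
    intro r hr
    have := lintegral_remIntensity_comp_mul (m := m) hr (measurable_one_sub_lap 1 1)
    simp only [Real.rpow_one, one_mul] at this
    simp_rw [← ENNReal.ofReal_mul' hr.le, mul_comm _ r, this, stableConst, Real.rpow_one, one_mul]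
    rw [ENNReal.ofReal_rpow_of_pos hr, mul_comm]
  induction x using ENNReal.recTopCoe with
  | top =>
    rw [ENNReal.top_rpow_of_pos hm, ENNReal.mul_top (stableConst_ne_zero one_pos hm),
      eq_top_iff]
    -- Only a lower bound is needed at `∞`: the integral dominates its values at `x = n + 1`, which
    -- tend to `∞` because the constant is nonzero.
    refine le_of_tendsto' (x := atTop)
      (f := fun n : ℕ => stableConst 1 1 m * ENNReal.ofReal ((n : ℝ) + 1) ^ m) ?_ fun n => ?_
    · have h1 : Tendsto (fun n : ℕ => ENNReal.ofReal ((n : ℝ) + 1) ^ m) atTop (𝓝 ∞) := by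
        have := (ENNReal.continuous_rpow_const (y := m)).tendsto ∞
        rw [ENNReal.top_rpow_of_pos hm] at this
        exact this.comp (ENNReal.tendsto_ofReal_nhds_top.2
          (tendsto_atTop_add_const_right _ _ tendsto_natCast_atTop_atTop))
      have := ENNReal.Tendsto.const_mul (a := stableConst 1 1 m) h1 (Or.inl ENNReal.top_ne_zero)
      rwa [ENNReal.mul_top (stableConst_ne_zero one_pos hm)] at this
    · rw [← key _ (by positivity)]
      exact lintegral_mono fun s => tsub_le_tsub_left (lap_antitone (mul_le_mul_right le_top _)) _
  | coe x =>
    rcases eq_or_ne x 0 with rfl | hx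
    · simp [ENNReal.zero_rpow_of_pos hm]
    · have := key x (by positivity)
      simpa using this

theorem lintegral_lap_mul (x : ℝ≥0∞) :
    ∫⁻ s in Ioi (0 : ℝ), lap (ENNReal.ofReal s * x) = x⁻¹ := by
  induction x using ENNReal.recTopCoe with
  | top =>
    rw [ENNReal.inv_top, setLIntegral_congr_fun measurableSet_Ioi (g := fun _ => 0)]
    · simp
    · intro s hs
      have hs : 0 < s := hs
      simp [ENNReal.mul_top, hs]
  | coe x =>
    rcases eq_or_ne x 0 with rfl | hx
    · simp
    · have hx' : (0 : ℝ) < x := by positivity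
      have h := ofReal_integral_eq_lintegral_ofReal
        (integrableOn_exp_mul_Ioi (neg_lt_zero.2 hx') 0) (ae_of_all _ fun s => (Real.exp_pos _).le)
      rw [integral_exp_mul_Ioi (neg_lt_zero.2 hx')] at h
      rw [setLIntegral_congr_fun (g := fun s => ENNReal.ofReal (Real.exp (-x * s)))
        measurableSet_Ioi, ← h]
      · simp only [mul_zero, Real.exp_zero, neg_div_neg_eq, one_div]
        rw [ENNReal.ofReal_inv_of_pos hx', ENNReal.ofReal_coe_nnreal]
      · intro s hs
        have hs : 0 < s := hs
        dsimp only
        rw [← ENNReal.ofReal_coe_nnreal, ← ENNReal.ofReal_mul hs.le, lap_ofReal (by positivity)]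
        congr 2
        ring

/-! ### Moments of stable variables -/

section Stable

variable {Ω : Type*} [MeasurableSpace Ω] {P : Measure Ω}

/-- Moments of a positive stable variable, given by its Laplace transform. -/
theorem lintegral_rpow_of_lap [IsProbabilityMeasure P] {X : Ω → ℝ≥0∞} (hX : Measurable X)
    {a c m p : ℝ} (hc : 0 < c) (hp : 0 < p)
    (h : ∀ t : ℝ, 0 < t → ∫⁻ ω, lap (ENNReal.ofReal t * X ω) ∂P =
      lap (ENNReal.ofReal (a * (c * t) ^ m))) :
    stableConst 1 1 p * ∫⁻ ω, X ω ^ p ∂P = ENNReal.ofReal (c ^ p) * stableConst a m p := by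
  have hmeas : Measurable fun q : Ω × ℝ => 1 - lap (ENNReal.ofReal q.2 * X q.1) :=
    measurable_const.sub (measurable_lap.comp (by fun_prop))
  rw [← lintegral_const_mul _ (by fun_prop)]
  -- The power `X^p` is written as a mixture of `1 - e^{-sX}`. Tonelli then reduces the moment to
  -- the Laplace transform, with no finiteness assumption.
  simp_rw [← lintegral_one_sub_lap_mul hp]
  rw [lintegral_lintegral_swap hmeas.aemeasurable, stableConst,
    ← lintegral_remIntensity_comp_mul hc (measurable_one_sub_lap a m)]
  refine lintegral_congr_ae ((ae_remIntensity_pos p).mono fun t ht => ?_)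
  dsimp only
  rw [lintegral_sub (f := fun _ => 1) (g := fun ω => lap (ENNReal.ofReal t * X ω))
    (measurable_lap.comp (by fun_prop)), h t ht]
  · simp
  · rw [h t ht]; exact lap_ne_top _
  · exact ae_of_all _ fun ω => lap_le_one _

/-- As `1/x = ∫ e^{-tx} dt`, Tonelli turns the inverse moment into the integral of `exp (-a c^m
t^m)`, which converges. This moment controls the logarithm where `X` is small. -/
theorem lintegral_inv_of_lap_lt_top [SFinite P] {X : Ω → ℝ≥0∞} (hX : Measurable X)
    {a c m : ℝ} (ha : 0 < a) (hc : 0 < c) (hm : 0 < m)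
    (h : ∀ t : ℝ, 0 < t → ∫⁻ ω, lap (ENNReal.ofReal t * X ω) ∂P =
      lap (ENNReal.ofReal (a * (c * t) ^ m))) :
    ∫⁻ ω, (X ω)⁻¹ ∂P < ∞ := by
  have hmeas : Measurable fun q : Ω × ℝ => lap (ENNReal.ofReal q.2 * X q.1) :=
    measurable_lap.comp (by fun_prop)
  simp_rw [← lintegral_lap_mul]
  rw [lintegral_lintegral_swap hmeas.aemeasurable]
  have hb : 0 < a * c ^ m := by positivity
  refine lt_of_le_of_lt ?_ (integrableOn_rpow_mul_exp_neg_mul_rpow (s := 0) (by norm_num)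
    hm hb).lintegral_lt_top
  refine setLIntegral_mono' measurableSet_Ioi fun t ht => ?_
  have ht : 0 < t := ht
  rw [h t ht, lap_ofReal (by positivity), Real.mul_rpow hc.le ht.le, Real.rpow_zero, one_mul]
  apply le_of_eq
  congr 2
  ring

end Stable

/-! ### Laplace functionals of Poisson processes and of marked REMs -/

theorem lap_natCast_mul (n : ℕ) (y : ℝ≥0∞) : lap (y * n) = lap y ^ n := by
  have := lap_sum (Finset.range n) fun _ => y
  simpa [mul_comm] using this

/-- This is the generating function `𝔼 u^N = e^{-(1-u)r}` at `u = e^{-y}`; the value `u = 0` covers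
`y = ∞`. -/
theorem lintegral_lap_poissonMeasure (r : ℝ≥0) (y : ℝ≥0∞) :
    ∫⁻ n : ℕ, lap (y * n) ∂(poissonMeasure r) = lap ((1 - lap y) * r) := by
  obtain ⟨u, hu⟩ : ∃ u : ℝ≥0, (u : ℝ≥0∞) = lap y :=
    ⟨(lap y).toNNReal, ENNReal.coe_toNNReal (lap_ne_top y)⟩
  have hu1 : u ≤ 1 := by have := lap_le_one y; rw [← hu] at this; exact_mod_cast this
  have hu1' : (u : ℝ) ≤ 1 := by exact_mod_cast hu1
  have hR : (1 - (u : ℝ≥0∞)) * r = ENNReal.ofReal ((1 - u) * r) := by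
    rw [ENNReal.ofReal_mul (sub_nonneg.2 hu1'), ENNReal.ofReal_sub _ u.coe_nonneg]
    simp
  have hnn : 0 ≤ (1 - (u : ℝ)) * r := mul_nonneg (sub_nonneg.2 hu1') r.coe_nonneg
  simp_rw [lap_natCast_mul, lintegral_countable', poissonMeasure_singleton]
  rw [← hu, hR, lap_ofReal hnn]
  have hs : HasSum (fun n : ℕ => Real.exp (-r) * ((u * r : ℝ) ^ n / n.factorial))
      (Real.exp (-r) * Real.exp (u * r)) := by
    rw [Real.exp_eq_exp_ℝ]
    exact (NormedSpace.expSeries_div_hasSum_exp (u * r : ℝ)).mul_left _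
  rw [← Real.exp_add] at hs
  rw [show -((1 - (u : ℝ)) * r) = -r + u * r by ring, ← hs.tsum_eq,
    ENNReal.ofReal_tsum_of_nonneg (fun n => by positivity) hs.summable]
  congr 1
  ext n
  rw [← ENNReal.ofReal_coe_nnreal, ← ENNReal.ofReal_pow u.coe_nonneg,
    ← ENNReal.ofReal_mul (by positivity)]
  congr 1
  rw [mul_pow]
  ring

section

variable {Ω E : Type*} [MeasurableSpace Ω] [MeasurableSpace E] {N : Ω → Measure E} {ν : Measure E}
  {P : Measure Ω}

theorem IsPoissonProcess.lintegral_lap_mul (h : IsPoissonProcess N ν P) (y : ℝ≥0∞) {A : Set E}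
    (hA : MeasurableSet A) (hν : ν A ≠ ∞) :
    ∫⁻ ω, lap (y * N ω A) ∂P = lap ((1 - lap y) * ν A) := by
  have hm : Measurable fun x : ℝ≥0∞ => lap (y * x) := measurable_lap.comp (by fun_prop)
  rw [(h.hasLaw A hA hν).lintegral_comp (f := fun x => lap (y * x)) hm.aemeasurable,
    lintegral_map hm measurable_from_top, lintegral_lap_poissonMeasure, ENNReal.coe_toNNReal hν]

/-- The fibres of `f` within `B` are disjoint, so their counts are independent Poisson variables and
the Laplace transform factorizes. Finite intensity of `B` is needed for the counts to be Poisson. -/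
theorem IsPoissonProcess.lintegral_lap_setLIntegral_simpleFunc (h : IsPoissonProcess N ν P)
    (hN : Measurable N) (f : SimpleFunc E ℝ≥0∞) {B : Set E} (hB : MeasurableSet B)
    (hν : ν B ≠ ∞) :
    ∫⁻ ω, lap (∫⁻ s in B, f s ∂(N ω)) ∂P = lap (∫⁻ s in B, (1 - lap (f s)) ∂ν) := by
  have hA : ∀ y, MeasurableSet (f ⁻¹' {y} ∩ B) := fun y => (f.measurableSet_fiber y).inter hB
  have hind : iIndepFun (fun (i : Fin f.range.card) ω =>
      N ω (f ⁻¹' {(f.range.equivFin.symm i : ℝ≥0∞)} ∩ B)) P := by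
    refine h.indep _ _ (fun i => hA _) fun i j hij => ?_
    refine Set.disjoint_left.2 ?_
    rintro s ⟨h1, _⟩ ⟨h2, _⟩
    exact hij (f.range.equivFin.symm.injective (Subtype.ext (h1.symm.trans h2)))
  have hlap := hind.comp (fun i x => lap ((f.range.equivFin.symm i : ℝ≥0∞) * x))
    fun i => measurable_lap.comp (by fun_prop)
  have key := lintegral_prod_eq_prod_lintegral_of_indepFun Finset.univ _ hlap
    (fun i => (measurable_lap.comp (by fun_prop)).comp (Measure.measurable_coe (hA _) |>.comp hN))
  simp only [Function.comp_apply] at key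
  have e1 : ∀ ω, lap (∫⁻ s in B, f s ∂(N ω)) = ∏ i : Fin f.range.card,
      lap ((f.range.equivFin.symm i : ℝ≥0∞) *
        N ω (f ⁻¹' {(f.range.equivFin.symm i : ℝ≥0∞)} ∩ B)) := by
    intro ω
    rw [SimpleFunc.lintegral_eq_lintegral, SimpleFunc.lintegral_restrict, lap_sum,
      Equiv.prod_comp f.range.equivFin.symm
        (fun y : f.range => lap ((y : ℝ≥0∞) * N ω (f ⁻¹' {(y : ℝ≥0∞)} ∩ B))),
      Finset.prod_coe_sort f.range (fun y => lap (y * N ω (f ⁻¹' {y} ∩ B)))]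
  simp_rw [e1, key]
  rw [Finset.prod_congr rfl fun i _ => h.lintegral_lap_mul _ (hA _)
    (measure_ne_top_of_subset inter_subset_right hν),
    Equiv.prod_comp f.range.equivFin.symm
        (fun y : f.range => lap ((1 - lap (y : ℝ≥0∞)) * ν (f ⁻¹' {(y : ℝ≥0∞)} ∩ B))),
      Finset.prod_coe_sort f.range (fun y => lap ((1 - lap y) * ν (f ⁻¹' {y} ∩ B))), ← lap_sum]
  congr 1
  have := SimpleFunc.lintegral_eq_lintegral (f.map fun y => 1 - lap y) (ν.restrict B)
  rw [SimpleFunc.map_lintegral] at this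
  simp only [SimpleFunc.map_apply] at this
  rw [this]
  exact Finset.sum_congr rfl fun y _ => by rw [Measure.restrict_apply (f.measurableSet_fiber y)]

/-- The Laplace functional of a Poisson process. -/
theorem IsPoissonProcess.lintegral_lap_lintegral [IsProbabilityMeasure P] [SigmaFinite ν]
    (h : IsPoissonProcess N ν P) (hN : Measurable N) {f : E → ℝ≥0∞} (hf : Measurable f) :
    ∫⁻ ω, lap (∫⁻ s, f s ∂(N ω)) ∂P = lap (∫⁻ s, (1 - lap (f s)) ∂ν) := by
  set F : ℕ → E → ℝ≥0∞ := fun n => (spanningSets ν n).indicator (SimpleFunc.eapprox f n) with hF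
  have hFm : ∀ n, Measurable (F n) := fun n =>
    (SimpleFunc.measurable _).indicator (measurableSet_spanningSets ν n)
  have hmono : Monotone F := fun n k hnk s => by
    refine (indicator_le_indicator (SimpleFunc.monotone_eapprox f hnk s)).trans ?_
    exact indicator_le_indicator_of_subset (monotone_spanningSets ν hnk) (fun _ => zero_le) s
  have hlim : ∀ s, Tendsto (fun n => F n s) atTop (𝓝 (f s)) := by
    intro s
    have h1 : Tendsto (fun n => SimpleFunc.eapprox f n s) atTop (𝓝 (f s)) := by
      rw [← SimpleFunc.iSup_eapprox_apply hf s]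
      exact tendsto_atTop_iSup fun n k hnk => SimpleFunc.monotone_eapprox f hnk s
    refine h1.congr' ?_
    filter_upwards [eventually_ge_atTop (spanningSetsIndex ν s)] with n hn
    exact (indicator_of_mem (monotone_spanningSets ν hn (mem_spanningSetsIndex ν s)) _).symm
  have hsimple : ∀ n, ∫⁻ ω, lap (∫⁻ s, F n s ∂(N ω)) ∂P = lap (∫⁻ s, (1 - lap (F n s)) ∂ν) := by
    intro n
    have := h.lintegral_lap_setLIntegral_simpleFunc hN (SimpleFunc.eapprox f n)
      (measurableSet_spanningSets ν n) (measure_spanningSets_lt_top ν n).ne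
    have e2 : ∀ s, 1 - lap (F n s) =
        (spanningSets ν n).indicator (fun s => 1 - lap (SimpleFunc.eapprox f n s)) s := by
      intro s
      by_cases hs : s ∈ spanningSets ν n <;> simp [hF, hs]
    simp_rw [e2, hF, lintegral_indicator (measurableSet_spanningSets ν n)]
    exact this
  have hleft : Tendsto (fun n => ∫⁻ ω, lap (∫⁻ s, F n s ∂(N ω)) ∂P) atTop
      (𝓝 (∫⁻ ω, lap (∫⁻ s, f s ∂(N ω)) ∂P)) := by
    refine tendsto_lintegral_of_dominated_convergence (fun _ => 1)
      (fun n => measurable_lap.comp ((Measure.measurable_lintegral (hFm n)).comp hN))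
      (fun n => ae_of_all _ fun ω => lap_le_one _) (by simp) (ae_of_all _ fun ω => ?_)
    exact (continuous_lap.tendsto _).comp (lintegral_tendsto_of_tendsto_of_monotone
      (fun n => (hFm n).aemeasurable) (ae_of_all _ fun s n k hnk => hmono hnk s)
      (ae_of_all _ hlim))
  have hright : Tendsto (fun n => lap (∫⁻ s, (1 - lap (F n s)) ∂ν)) atTop
      (𝓝 (lap (∫⁻ s, (1 - lap (f s)) ∂ν))) := by
    refine (continuous_lap.tendsto _).comp (lintegral_tendsto_of_tendsto_of_monotone
      (fun n => (measurable_const.sub (measurable_lap.comp (hFm n))).aemeasurable)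
      (ae_of_all _ fun s n k hnk => tsub_le_tsub_left (lap_antitone (hmono hnk s)) _)
      (ae_of_all _ fun s => ?_))
    exact ENNReal.Tendsto.sub tendsto_const_nhds ((continuous_lap.tendsto _).comp (hlim s))
      (Or.inl ENNReal.one_ne_top)
  exact tendsto_nhds_unique hleft (hright.congr fun n => (hsimple n).symm)

theorem measurable_sum_dirac {ζ : ℕ → Ω → E} (hζ : ∀ j, Measurable (ζ j)) :
    Measurable fun ω => Measure.sum fun j => Measure.dirac (ζ j ω) := by
  refine Measure.measurable_of_measurable_coe _ fun A hA => ?_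
  simp_rw [Measure.sum_apply _ hA]
  exact Measurable.tsum fun j => (Measure.measurable_coe hA).comp
    (Measure.measurable_dirac.comp (hζ j))

/-- A REM with independent marks: the Laplace transform of `∑ ζ_j Y_j`. -/
theorem IsREM.lintegral_lap_tsum [IsProbabilityMeasure P] {m : ℝ} (hm : 0 < m)
    {ζ : ℕ → Ω → ℝ} (h : IsREM m ζ P) {Y : ℕ → Ω → ℝ≥0∞} (hY : ∀ j, Measurable (Y j))
    (hind : iIndepFun Y P) (hζY : IndepFun (fun ω j => ζ j ω) (fun ω j => Y j ω) P)
    {φ : ℝ → ℝ≥0∞} (hφ : ∀ j, ∀ t, 0 < t → ∫⁻ ω, lap (ENNReal.ofReal t * Y j ω) ∂P = φ t)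
    {M : ℝ≥0∞} (hM : ∫⁻ ω, Y 0 ω ^ m ∂P = M) {t : ℝ} (ht : 0 < t) :
    ∫⁻ ω, lap (ENNReal.ofReal t * ∑' j, ENNReal.ofReal (ζ j ω) * Y j ω) ∂P =
      lap (stableConst 1 1 m * ENNReal.ofReal (t ^ m) * M) := by
  set ψ : ℝ → ℝ≥0∞ := fun s => ∫⁻ ω, lap (ENNReal.ofReal (t * s) * Y 0 ω) ∂P with hψ
  have hψm : Measurable ψ := by
    have : Measurable fun q : ℝ × Ω => lap (ENNReal.ofReal (t * q.1) * Y 0 q.2) :=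
      measurable_lap.comp (by have := hY 0; fun_prop)
    exact this.lintegral_prod_right'
  have hψ1 : ∀ s, ψ s ≤ 1 := fun s =>
    (lintegral_mono fun ω => lap_le_one _).trans (by simp)
  have hψ_eq : ∀ j s, 0 < s → ∫⁻ ω, lap (ENNReal.ofReal (t * s) * Y j ω) ∂P = ψ s := by
    intro j s hs
    rw [hψ, hφ j _ (mul_pos ht hs), ← hφ 0 _ (mul_pos ht hs)]
  -- `H = -log ψ`, with value `∞` where `ψ` vanishes. It turns the product of the marks' Laplace
  -- transforms into a single exponential of a sum over the points, to which the Poisson functional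
  -- applies.
  set H : ℝ → ℝ≥0∞ := fun s => EReal.toENNReal (-(ENNReal.log (ψ s))) with hH
  have hHm : Measurable H := by
    have := (ENNReal.measurable_log.comp hψm)
    exact (measurable_ereal_toENNReal.comp (continuous_neg.measurable.comp this))
  have hHlap : ∀ s, lap (H s) = ψ s := by
    intro s
    have : (0 : EReal) ≤ -(ENNReal.log (ψ s)) := by
      simpa using hψ1 s
    rw [hH, lap, EReal.coe_toENNReal this, EReal.exp_neg, ENNReal.exp_log, inv_inv]
  -- The average over the marks alone, with the points frozen at `z`.
  have hcond : ∀ z : ℕ → ℝ, (∀ j, 0 < z j) →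
      ∫⁻ ω, lap (ENNReal.ofReal t * ∑' j, ENNReal.ofReal (z j) * Y j ω) ∂P =
        lap (∑' j, H (z j)) := by
    intro z hz
    have hfin : ∀ n, ∫⁻ ω, ∏ j ∈ Finset.range n, lap (ENNReal.ofReal (t * z j) * Y j ω) ∂P =
        ∏ j ∈ Finset.range n, lap (H (z j)) := by
      intro n
      have := lintegral_prod_eq_prod_lintegral_of_indepFun (Finset.range n) _
        (hind.comp (fun j y => lap (ENNReal.ofReal (t * z j) * y))
          fun j => measurable_lap.comp (by fun_prop))
        (fun j => (measurable_lap.comp (by fun_prop)).comp (hY j))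
      simp only [Function.comp_apply] at this
      rw [this]
      exact Finset.prod_congr rfl fun j _ => by rw [hψ_eq j _ (hz j), hHlap]
    refine tendsto_nhds_unique ?_ (tendsto_prod_lap fun j => H (z j))
    refine Tendsto.congr hfin ?_
    refine tendsto_lintegral_of_dominated_convergence (fun _ => 1)
      (fun n => Finset.measurable_prod _ fun j _ =>
        (measurable_lap.comp (by have := hY j; fun_prop)))
      (fun n => ae_of_all _ fun ω => Finset.prod_le_one' fun j _ => lap_le_one _) (by simp)
      (ae_of_all _ fun ω => ?_)
    rw [← ENNReal.tsum_mul_left]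
    simp_rw [← mul_assoc, ← ENNReal.ofReal_mul ht.le]
    exact tendsto_prod_lap _
  have hprod := (indepFun_iff_map_prod_eq_prod_map_map
    (measurable_pi_lambda _ h.measurable).aemeasurable
    (measurable_pi_lambda _ hY).aemeasurable).1 hζY
  have hG : Measurable fun q : (ℕ → ℝ) × (ℕ → ℝ≥0∞) =>
      lap (ENNReal.ofReal t * ∑' j, ENNReal.ofReal (q.1 j) * q.2 j) := by
    refine measurable_lap.comp (Measurable.const_mul (Measurable.tsum fun j => ?_) _)
    fun_prop
  have hζm : Measurable fun ω j => ζ j ω := measurable_pi_lambda _ h.measurable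
  have hYm : Measurable fun ω j => Y j ω := measurable_pi_lambda _ hY
  have : ∫⁻ ω, lap (ENNReal.ofReal t * ∑' j, ENNReal.ofReal (ζ j ω) * Y j ω) ∂P =
      ∫⁻ ω, lap (∑' j, H (ζ j ω)) ∂P := by
    have h1 := lintegral_map (μ := P) hG (hζm.prodMk hYm)
    rw [hprod, lintegral_prod _ hG.aemeasurable, lintegral_map (hG.lintegral_prod_right') hζm] at h1
    rw [← h1]
    refine lintegral_congr_ae (h.pos.mono fun ω hω => ?_)
    have h4 := lintegral_map (μ := P) (hG.comp (measurable_prodMk_left (x := fun j => ζ j ω))) hYm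
    exact h4.trans (hcond _ hω)
  rw [this]
  have h2 := h.poisson.lintegral_lap_lintegral (measurable_sum_dirac h.measurable) hHm
  simp_rw [lintegral_sum_measure, lintegral_dirac' _ hHm] at h2
  rw [h2]
  congr 1
  simp_rw [hHlap, hψ]
  have h3 : ∀ s, 1 - ∫⁻ ω, lap (ENNReal.ofReal (t * s) * Y 0 ω) ∂P =
      ∫⁻ ω, (1 - lap (ENNReal.ofReal (t * s) * Y 0 ω)) ∂P := by
    intro s
    rw [lintegral_sub (f := fun _ => 1) (g := fun ω => lap (ENNReal.ofReal (t * s) * Y 0 ω))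
      (measurable_lap.comp (by have := hY 0; fun_prop))
      ((hψ1 s).trans_lt ENNReal.one_lt_top).ne (ae_of_all _ fun ω => lap_le_one _)]
    simp
  simp_rw [h3]
  have hmeas : Measurable fun q : ℝ × Ω => 1 - lap (ENNReal.ofReal (t * q.1) * Y 0 q.2) :=
    measurable_const.sub (measurable_lap.comp (by have := hY 0; fun_prop))
  rw [lintegral_lintegral_swap hmeas.aemeasurable]
  -- After the swap the inner integral in `s` is the stable integral at `t Y`, equal to `C (tY)^m`;
  -- this is where the marks reduce to one moment.
  simp_rw [ENNReal.ofReal_mul ht.le, mul_comm (ENNReal.ofReal t), mul_assoc,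
    lintegral_one_sub_lap_mul hm, ENNReal.mul_rpow_of_nonneg _ _ hm.le]
  rw [lintegral_const_mul _ (by have := hY 0; fun_prop),
    lintegral_const_mul _ (by have := hY 0; fun_prop), hM, ENNReal.ofReal_rpow_of_pos ht]

end

/-! ### Independence of disjoint blocks of σ-algebras -/

theorem measurable_tsum_ennreal {α : Type*} {m : MeasurableSpace α} {f : ℕ → α → ℝ≥0∞}
    (hf : ∀ j, Measurable (f j)) : Measurable fun x => ∑' j, f j x := Measurable.tsum hf

theorem biSup_block_mono {Ω ι : Type*} {σ : ι → MeasurableSpace Ω} {S T : Set ι} (h : S ⊆ T) :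
    (⨆ i ∈ S, σ i) ≤ ⨆ i ∈ T, σ i :=
  biSup_mono fun _ hi => h hi

section Blocks

variable {Ω ι κ : Type*} {mΩ : MeasurableSpace Ω} {P : Measure Ω} {σ : ι → MeasurableSpace Ω}

/-- Blocks are peeled off one at a time: an intersection of events from the remaining blocks is
measurable for the σ-algebra of their union, which is disjoint from the block removed. -/
theorem iIndep_iSup_of_pairwise_disjoint (hle : ∀ i, σ i ≤ mΩ) (hσ : iIndep σ P) {B : κ → Set ι}
    (hB : Pairwise fun a b => Disjoint (B a) (B b)) : iIndep (fun a => ⨆ i ∈ B a, σ i) P := by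
  classical
  have := hσ.isProbabilityMeasure
  rw [iIndep_iff]
  intro s
  induction s using Finset.induction_on with
  | empty => simp
  | insert a s ha ih =>
    intro f hf
    rw [Finset.set_biInter_insert, Finset.prod_insert ha,
      ← ih fun i hi => hf i (Finset.mem_insert_of_mem hi)]
    have hdisj : Disjoint (B a) (⋃ b ∈ s, B b) := by
      simp only [disjoint_iUnion_right]
      exact fun b hb => hB (ne_of_mem_of_not_mem hb ha).symm
    refine (Indep_iff _ _ _).1 (indep_iSup_of_disjoint hle hσ hdisj) _ _
      (hf a (Finset.mem_insert_self _ _)) (Finset.measurableSet_biInter _ fun b hb => ?_)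
    have hmono : (⨆ i ∈ B b, σ i) ≤ ⨆ i ∈ ⋃ b ∈ s, B b, σ i :=
      biSup_mono fun i hi => mem_biUnion hb hi
    exact hmono _ (hf b (Finset.mem_insert_of_mem hb))

theorem IndepFun.of_measurable_iSup {β γ : Type*} [MeasurableSpace β] [MeasurableSpace γ]
    (hle : ∀ i, σ i ≤ mΩ) (hσ : iIndep σ P) {S T : Set ι} (hST : Disjoint S T) {f : Ω → β}
    {g : Ω → γ} (hf : Measurable[⨆ i ∈ S, σ i] f) (hg : Measurable[⨆ i ∈ T, σ i] g) :
    IndepFun f g P := by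
  rw [IndepFun_iff_Indep]
  exact indep_of_indep_of_le (indep_iSup_of_disjoint hle hσ hST) hf.comap_le hg.comap_le

theorem iIndepFun.of_measurable_iSup {β : κ → Type*} [∀ a, MeasurableSpace (β a)]
    (hle : ∀ i, σ i ≤ mΩ) (hσ : iIndep σ P) {B : κ → Set ι}
    (hB : Pairwise fun a b => Disjoint (B a) (B b)) {f : ∀ a, Ω → β a}
    (hf : ∀ a, Measurable[⨆ i ∈ B a, σ i] (f a)) : iIndepFun f P := by
  rw [iIndepFun_iff_iIndep]
  exact iIndep_of_iIndep_of_le (iIndep_iSup_of_pairwise_disjoint hle hσ hB) fun a => (hf a).comap_le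

end Blocks

/-! ### Recursive sums over a tree and their independence structure -/

section Tree

variable {Ω ι : Type*} [mΩ : MeasurableSpace Ω]

/-- The total weight of the tree of depth `d` planted at the word `w`: the edge from `w` to `w j`
carries the weight `Z w j`, and the node `w j` the weight `exp (β H (w j))`. -/
noncomputable def treeSum (Z : List ℕ → ℕ → Ω → ℝ) (H : List ℕ → Ω → ℝ) (β : ℝ) :
    ℕ → List ℕ → Ω → ℝ≥0∞
  | 0, _, _ => 1
  | d + 1, w, ω => ∑' j, ENNReal.ofReal (Z w j ω) *
      (ENNReal.ofReal (Real.exp (β * H (w ++ [j]) ω)) * treeSum Z H β d (w ++ [j]) ω)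

/-- The weight of the tree at `w` including the weight of its root. -/
noncomputable def rootedSum (Z : List ℕ → ℕ → Ω → ℝ) (H : List ℕ → Ω → ℝ) (β : ℝ) (d : ℕ)
    (w : List ℕ) (ω : Ω) : ℝ≥0∞ :=
  ENNReal.ofReal (Real.exp (β * H w ω)) * treeSum Z H β d w ω

/-- Independent REMs and centered Gaussian variables indexed by the words of length at most `k`. -/
structure IsTreeField (k : ℕ) (m : ℕ → ℝ) (v : ℕ → ℝ≥0) (Z : List ℕ → ℕ → Ω → ℝ)
    (H : List ℕ → Ω → ℝ) (σ : ι → MeasurableSpace Ω) (pos : ι → List ℕ ⊕ List ℕ)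
    (P : Measure Ω) : Prop where
  le : ∀ i, σ i ≤ mΩ
  indep : iIndep σ P
  measurable_rem : ∀ w j, Measurable[⨆ i ∈ {i | pos i = Sum.inl w}, σ i] (Z w j)
  measurable_gauss : ∀ w, Measurable[⨆ i ∈ {i | pos i = Sum.inr w}, σ i] (H w)
  isREM : ∀ w, w.length < k → IsREM (m w.length) (Z w) P
  hasLaw : ∀ w, w.length ≤ k → HasLaw (H w) (gaussianReal 0 (v w.length)) P
  param_pos : ∀ l, l < k → 0 < m l
  param_lt_one : ∀ l, l < k → m l < 1
  param_lt : ∀ l, l + 1 < k → m l < m (l + 1)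

/-- The indices at or below the node `w`. -/
def rootedBlock (pos : ι → List ℕ ⊕ List ℕ) (w : List ℕ) : Set ι :=
  {i | ∃ u, (pos i = Sum.inl u ∨ pos i = Sum.inr u) ∧ w <+: u}

/-- The indices at or below the node `w`, without the Gaussian variable at `w`. -/
def treeBlock (pos : ι → List ℕ ⊕ List ℕ) (w : List ℕ) : Set ι :=
  {i | i ∈ rootedBlock pos w ∧ pos i ≠ Sum.inr w}

variable {k : ℕ} {m : ℕ → ℝ} {v : ℕ → ℝ≥0} {Z : List ℕ → ℕ → Ω → ℝ} {H : List ℕ → Ω → ℝ}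
  {σ : ι → MeasurableSpace Ω} {pos : ι → List ℕ ⊕ List ℕ} {P : Measure Ω}

theorem rootedBlock_append_subset (w : List ℕ) (j : ℕ) :
    rootedBlock pos (w ++ [j]) ⊆ treeBlock pos w := by
  rintro i ⟨u, hu, hw⟩
  refine ⟨⟨u, hu, (List.prefix_append w [j]).trans hw⟩, fun h => ?_⟩
  have hlen := hw.length_le
  rcases hu with hu | hu <;> rw [h] at hu
  · simp at hu
  · obtain rfl : w = u := by simpa using hu
    simp at hlen

theorem disjoint_rootedBlock (w : List ℕ) :
    Pairwise fun a b : ℕ => Disjoint (rootedBlock pos (w ++ [a])) (rootedBlock pos (w ++ [b])) := by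
  intro a b hab
  rw [Set.disjoint_left]
  rintro i ⟨u, hu, hwu⟩ ⟨u', hu', hwu'⟩
  obtain rfl : u = u' := by
    rcases hu with hu | hu <;> rcases hu' with hu' | hu' <;> simp_all
  have := (List.prefix_of_prefix_length_le hwu hwu' (by simp)).eq_of_length (by simp)
  exact hab (by simpa using this)

theorem disjoint_rem_rootedBlock (w : List ℕ) :
    Disjoint {i | pos i = Sum.inl w} (⋃ j : ℕ, rootedBlock pos (w ++ [j])) := by
  rw [Set.disjoint_left]
  rintro i hi hi'
  obtain ⟨j, u, hu, hwu⟩ := mem_iUnion.1 hi'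
  have hi : pos i = Sum.inl w := hi
  have hlen := hwu.length_le
  rcases hu with hu | hu <;> rw [hi] at hu
  · obtain rfl : w = u := by simpa using hu
    simp at hlen
  · simp at hu

theorem disjoint_gauss_treeBlock (w : List ℕ) :
    Disjoint {i | pos i = Sum.inr w} (treeBlock pos w) :=
  Set.disjoint_left.2 fun _ hi hi' => hi'.2 hi

namespace IsTreeField

variable (h : IsTreeField k m v Z H σ pos P)
include h

theorem measurable_exp_block (β : ℝ) (w : List ℕ) :
    Measurable[⨆ i ∈ {i | pos i = Sum.inr w}, σ i]
      fun ω => ENNReal.ofReal (Real.exp (β * H w ω)) :=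
  (ENNReal.measurable_ofReal.comp (Real.measurable_exp.comp (measurable_const_mul β))).comp
    (h.measurable_gauss w)

theorem measurable_treeSum_block (β : ℝ) (d : ℕ) (w : List ℕ) :
    Measurable[⨆ i ∈ treeBlock pos w, σ i] (treeSum Z H β d w) := by
  induction d generalizing w with
  | zero => exact measurable_const
  | succ d ih =>
    refine measurable_tsum_ennreal (f := fun j ω => ENNReal.ofReal (Z w j ω) *
      (ENNReal.ofReal (Real.exp (β * H (w ++ [j]) ω)) * treeSum Z H β d (w ++ [j]) ω)) fun j =>
        Measurable.mul ?_ (Measurable.mul ?_ ?_)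
    · refine (ENNReal.measurable_ofReal.comp (h.measurable_rem w j)).mono
        (biSup_block_mono fun i hi => ⟨⟨w, Or.inl hi, List.prefix_refl w⟩, ?_⟩) le_rfl
      rw [show pos i = Sum.inl w from hi]
      simp
    · refine (h.measurable_exp_block β (w ++ [j])).mono (biSup_block_mono ?_) le_rfl
      refine Subset.trans (fun i hi => ?_) (rootedBlock_append_subset w j)
      exact ⟨w ++ [j], Or.inr hi, List.prefix_refl _⟩
    · exact (ih (w ++ [j])).mono
        (biSup_block_mono fun _ hi => rootedBlock_append_subset w j hi.1) le_rfl

theorem measurable_rootedSum_block (β : ℝ) (d : ℕ) (w : List ℕ) :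
    Measurable[⨆ i ∈ rootedBlock pos w, σ i] (rootedSum Z H β d w) :=
  Measurable.mul ((h.measurable_exp_block β w).mono (biSup_block_mono fun _ hi =>
      ⟨w, Or.inr hi, List.prefix_refl _⟩) le_rfl)
    ((h.measurable_treeSum_block β d w).mono (biSup_block_mono fun _ hi => hi.1) le_rfl)

theorem iSup_le (S : Set ι) : (⨆ i ∈ S, σ i) ≤ mΩ := iSup₂_le fun i _ => h.le i

theorem measurable_H (w : List ℕ) : Measurable (H w) :=
  (h.measurable_gauss w).mono (h.iSup_le _) le_rfl

theorem measurable_treeSum (β : ℝ) (d : ℕ) (w : List ℕ) : Measurable (treeSum Z H β d w) :=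
  (h.measurable_treeSum_block β d w).mono (h.iSup_le _) le_rfl

theorem measurable_rootedSum (β : ℝ) (d : ℕ) (w : List ℕ) : Measurable (rootedSum Z H β d w) :=
  (h.measurable_rootedSum_block β d w).mono (h.iSup_le _) le_rfl

theorem isProbabilityMeasure : IsProbabilityMeasure P := h.indep.isProbabilityMeasure

theorem indepFun_gauss_treeSum (β : ℝ) (d : ℕ) (w : List ℕ) :
    IndepFun (H w) (treeSum Z H β d w) P :=
  IndepFun.of_measurable_iSup h.le h.indep (disjoint_gauss_treeBlock w) (h.measurable_gauss w)
    (h.measurable_treeSum_block β d w)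

theorem iIndepFun_rootedSum (β : ℝ) (d : ℕ) (w : List ℕ) :
    iIndepFun (fun j => rootedSum Z H β d (w ++ [j])) P :=
  iIndepFun.of_measurable_iSup h.le h.indep (disjoint_rootedBlock w)
    fun j => h.measurable_rootedSum_block β d (w ++ [j])

theorem indepFun_rem_rootedSum (β : ℝ) (d : ℕ) (w : List ℕ) :
    IndepFun (fun ω j => Z w j ω) (fun ω j => rootedSum Z H β d (w ++ [j]) ω) P := by
  refine IndepFun.of_measurable_iSup h.le h.indep (disjoint_rem_rootedBlock w)
    (@measurable_pi_lambda _ _ _ (_) _ _ (h.measurable_rem w))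
    (@measurable_pi_lambda _ _ _ (_) _ _ fun j => ?_)
  exact (h.measurable_rootedSum_block β d (w ++ [j])).mono
    (biSup_block_mono (subset_iUnion (fun j => rootedBlock pos (w ++ [j])) j)) le_rfl

theorem lintegral_exp_rpow (β p : ℝ) {w : List ℕ} (hw : w.length ≤ k) :
    ∫⁻ ω, ENNReal.ofReal (Real.exp (β * H w ω)) ^ p ∂P =
      ENNReal.ofReal (Real.exp (v w.length * (p * β) ^ 2 / 2)) := by
  have hmap := (h.hasLaw w hw).map_eq
  have h1 : ∀ ω, ENNReal.ofReal (Real.exp (β * H w ω)) ^ p =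
      ENNReal.ofReal (Real.exp ((p * β) * H w ω)) := by
    intro ω
    rw [ENNReal.ofReal_rpow_of_pos (Real.exp_pos _), ← Real.exp_mul]
    congr 2; ring
  have hint : Integrable (fun ω => Real.exp ((p * β) * H w ω)) P := by
    have := integrable_exp_mul_gaussianReal (μ := 0) (v := v w.length) (p * β)
    rw [← hmap] at this
    exact this.comp_measurable (h.measurable_H w)
  simp_rw [h1]
  rw [← ofReal_integral_eq_lintegral_ofReal hint (ae_of_all _ fun _ => (Real.exp_pos _).le)]
  have := mgf_gaussianReal (X := H w) hmap (p * β)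
  rw [mgf] at this
  rw [this]
  simp

theorem lintegral_rootedSum_rpow (β : ℝ) {p : ℝ} (hp : 0 ≤ p) (d : ℕ) {w : List ℕ}
    (hw : w.length ≤ k) :
    ∫⁻ ω, rootedSum Z H β d w ω ^ p ∂P =
      ENNReal.ofReal (Real.exp (v w.length * (p * β) ^ 2 / 2)) *
        ∫⁻ ω, treeSum Z H β d w ω ^ p ∂P := by
  have hind := (h.indepFun_gauss_treeSum β d w).comp
    (φ := fun y => ENNReal.ofReal (Real.exp (β * y)) ^ p) (ψ := fun x => x ^ p)
    (by fun_prop) (by fun_prop)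
  have hH := h.measurable_H w
  have hS := h.measurable_treeSum β d w
  have := lintegral_mul_eq_lintegral_mul_lintegral_of_indepFun (μ := P)
    (f := (fun y => ENNReal.ofReal (Real.exp (β * y)) ^ p) ∘ H w)
    (g := (fun x => x ^ p) ∘ treeSum Z H β d w)
    (by fun_prop) (by fun_prop) hind
  rw [← h.lintegral_exp_rpow β p hw]
  simp only [Function.comp_def, Pi.mul_apply] at this
  simp_rw [rootedSum, ENNReal.mul_rpow_of_nonneg _ _ hp]
  exact this

/-- Independence of the root variable and the tree below it lets one integrate out the root last.
Hence equality of Laplace transforms across nodes of one level passes from `treeSum` to `rootedSum`.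
-/
theorem lintegral_lap_rootedSum (β : ℝ) (d : ℕ) {w : List ℕ} (hw : w.length ≤ k) (t : ℝ) :
    ∫⁻ ω, lap (ENNReal.ofReal t * rootedSum Z H β d w ω) ∂P =
      ∫⁻ y, ∫⁻ ω, lap (ENNReal.ofReal (t * Real.exp (β * y)) * treeSum Z H β d w ω) ∂P
        ∂(gaussianReal 0 (v w.length)) := by
  have := h.isProbabilityMeasure
  have hH := h.measurable_H w
  have hS := h.measurable_treeSum β d w
  have hprod := (indepFun_iff_map_prod_eq_prod_map_map hH.aemeasurable hS.aemeasurable).1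
    (h.indepFun_gauss_treeSum β d w)
  have hG : Measurable fun q : ℝ × ℝ≥0∞ =>
      lap (ENNReal.ofReal (t * Real.exp (β * q.1)) * q.2) := measurable_lap.comp (by fun_prop)
  have h1 := lintegral_map (μ := P) hG (hH.prodMk hS)
  rw [hprod, lintegral_prod _ hG.aemeasurable, (h.hasLaw w hw).map_eq] at h1
  simp_rw [rootedSum, ← mul_assoc, ← ENNReal.ofReal_mul' (Real.exp_pos _).le]
  rw [← h1]
  refine lintegral_congr fun y => ?_
  exact lintegral_map (hG.comp (measurable_prodMk_left (x := y))) hS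

end IsTreeField

/-! ### The law of a tree sum, up to scale -/

/-- The scale `λ` of the tree of depth `d` planted at level `l`. -/
noncomputable def treeScale (m : ℕ → ℝ) (v : ℕ → ℝ≥0) (β : ℝ) : ℕ → ℕ → ℝ
  | 0, _ => 1
  | d + 1, l => treeScale m v β d (l + 1) * Real.exp (v (l + 1) * β ^ 2 * m l / 2)

theorem treeScale_pos (m : ℕ → ℝ) (v : ℕ → ℝ≥0) (β : ℝ) (d l : ℕ) : 0 < treeScale m v β d l := by
  induction d generalizing l with
  | zero => exact one_pos
  | succ d ih => exact mul_pos (ih _) (Real.exp_pos _)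

theorem treeScale_zero (m : ℕ → ℝ) (v : ℕ → ℝ≥0) (d l : ℕ) : treeScale m v 0 d l = 1 := by
  induction d generalizing l with
  | zero => rfl
  | succ d ih => simp [treeScale, ih]

theorem log_treeScale (m : ℕ → ℝ) (v : ℕ → ℝ≥0) (β : ℝ) (d l : ℕ) :
    Real.log (treeScale m v β d l) =
      β ^ 2 / 2 * ∑ i ∈ Finset.range d, m (l + i) * v (l + i + 1) := by
  induction d generalizing l with
  | zero => simp [treeScale]
  | succ d ih =>
    rw [treeScale, Real.log_mul (treeScale_pos _ _ _ _ _).ne' (Real.exp_pos _).ne', ih,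
      Real.log_exp, Finset.sum_range_succ']
    have : ∀ i, l + 1 + i = l + (i + 1) := fun i => by ring
    simp_rw [this, add_zero]
    ring

/-- The laws of the tree sums of depth `d` planted at level `l` agree up to the scale `λ`. -/
structure TreeLaw (m : ℕ → ℝ) (v : ℕ → ℝ≥0) (Z : List ℕ → ℕ → Ω → ℝ)
    (H : List ℕ → Ω → ℝ) (P : Measure Ω) (d l : ℕ) : Prop where
  moment : ∀ p, 0 < p → (d = 0 ∨ p < m l) → ∃ b : ℝ≥0∞, b ≠ 0 ∧ b ≠ ∞ ∧ ∀ β w, w.length = l →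
    ∫⁻ ω, treeSum Z H β d w ω ^ p ∂P = ENNReal.ofReal (treeScale m v β d l ^ p) * b
  laplace : ∀ β, ∃ Φ : ℝ → ℝ≥0∞, ∀ w, w.length = l → ∀ t, 0 < t →
    ∫⁻ ω, lap (ENNReal.ofReal t * treeSum Z H β d w ω) ∂P = Φ t
  inv : ∀ β w, w.length = l → ∫⁻ ω, (treeSum Z H β d w ω)⁻¹ ∂P < ∞

/-- One application of the marked-REM formula, the marks being the rooted sums of the children. It
gives a Laplace transform that is stable of index `m l`, from which the moments of order below `m l`
and the inverse moment follow. -/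
theorem IsTreeField.treeLaw_succ (h : IsTreeField k m v Z H σ pos P) {d l : ℕ}
    (hl : l + (d + 1) = k) (ih : TreeLaw m v Z H P d (l + 1)) : TreeLaw m v Z H P (d + 1) l := by
  have hprob := h.isProbabilityMeasure
  have hlk : l < k := by omega
  have hm := h.param_pos l hlk
  have hm1 := h.param_lt_one l hlk
  -- The order `m l` is admissible one level down, either because `m l < m (l + 1)` or because the
  -- subtree is a single leaf.
  obtain ⟨b, hb0, hbt, hb⟩ := ih.moment (m l) hm (by
    rcases d.eq_zero_or_pos with hd | hd
    · exact Or.inl hd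
    · exact Or.inr (h.param_lt l (by omega)))
  have hC0 : stableConst 1 1 (m l) ≠ 0 := stableConst_ne_zero one_pos hm
  have hCt : stableConst 1 1 (m l) ≠ ∞ := stableConst_ne_top one_pos hm hm1
  -- The constant inherits from `b` that it does not involve `β`.
  set a : ℝ := (stableConst 1 1 (m l) * b).toReal with ha_def
  have hat : stableConst 1 1 (m l) * b ≠ ∞ := ENNReal.mul_ne_top hCt hbt
  have ha : 0 < a := ENNReal.toReal_pos (mul_ne_zero hC0 hb0) hat
  have key : ∀ β w, w.length = l → ∀ t : ℝ, 0 < t →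
      ∫⁻ ω, lap (ENNReal.ofReal t * treeSum Z H β (d + 1) w ω) ∂P =
        lap (ENNReal.ofReal (a * (treeScale m v β (d + 1) l * t) ^ m l)) := by
    intro β w hw t ht
    obtain ⟨Φ, hΦ⟩ := ih.laplace β
    have hlen : ∀ j : ℕ, (w ++ [j]).length = l + 1 := fun j => by simp [hw]
    have hrem := h.isREM w (by omega)
    rw [hw] at hrem
    -- The Gaussian factor `exp (v (mβ)^2 / 2)` is the `m`-th power of `exp (v β^2 m / 2)`, the new
    -- factor in `treeScale`.
    have hM : ∫⁻ ω, rootedSum Z H β d (w ++ [0]) ω ^ m l ∂P =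
        ENNReal.ofReal (treeScale m v β (d + 1) l ^ m l) * b := by
      rw [h.lintegral_rootedSum_rpow β hm.le d (by rw [hlen]; omega), hb β _ (hlen 0), hlen,
        ← mul_assoc, ← ENNReal.ofReal_mul (Real.exp_pos _).le, treeScale,
        Real.mul_rpow (treeScale_pos _ _ _ _ _).le (Real.exp_pos _).le, ← Real.exp_mul,
        mul_comm (Real.exp _)]
      congr 4
      ring
    have := hrem.lintegral_lap_tsum hm (fun j => h.measurable_rootedSum β d (w ++ [j]))
      (h.iIndepFun_rootedSum β d w) (h.indepFun_rem_rootedSum β d w)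
      (φ := fun t => ∫⁻ y, Φ (t * Real.exp (β * y)) ∂(gaussianReal 0 (v (l + 1))))
      (fun j t ht => by
        rw [h.lintegral_lap_rootedSum β d (by rw [hlen]; omega), hlen]
        exact lintegral_congr fun y => hΦ _ (hlen j) _ (mul_pos ht (Real.exp_pos _)))
      hM ht
    refine this.trans ?_
    congr 1
    rw [ENNReal.ofReal_mul ha.le, ha_def, ENNReal.ofReal_toReal hat,
      Real.mul_rpow (treeScale_pos _ _ _ _ _).le ht.le,
      ENNReal.ofReal_mul (Real.rpow_nonneg (treeScale_pos _ _ _ _ _).le _)]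
    ring
  refine ⟨fun p hp hpm => ?_, fun β => ⟨_, key β⟩, fun β w hw => ?_⟩
  · replace hpm : p < m l := by simpa using hpm
    have hD0 : stableConst 1 1 p ≠ 0 := stableConst_ne_zero one_pos hp
    have hDt : stableConst 1 1 p ≠ ∞ := stableConst_ne_top one_pos hp (hpm.trans hm1)
    refine ⟨stableConst a (m l) p / stableConst 1 1 p,
      (ENNReal.div_pos (stableConst_ne_zero ha hp) hDt).ne',
      ENNReal.div_ne_top (stableConst_ne_top ha hp hpm) hD0, fun β w hw => ?_⟩
    have := lintegral_rpow_of_lap (h.measurable_treeSum β (d + 1) w) (treeScale_pos m v β (d + 1) l)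
      hp (key β w hw)
    rw [← mul_div_assoc, ← this, mul_comm, ENNReal.mul_div_cancel_right hD0 hDt]
  · exact lintegral_inv_of_lap_lt_top (h.measurable_treeSum β (d + 1) w) ha
      (treeScale_pos m v β (d + 1) l) hm (key β w hw)

theorem IsTreeField.treeLaw (h : IsTreeField k m v Z H σ pos P) (d l : ℕ) (hl : l + d = k) :
    TreeLaw m v Z H P d l := by
  have hprob := h.isProbabilityMeasure
  induction d generalizing l with
  | zero =>
    refine ⟨fun p hp _ => ⟨1, one_ne_zero, ENNReal.one_ne_top, fun β w _ => ?_⟩,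
      fun β => ⟨fun t => lap (ENNReal.ofReal t), fun w _ t _ => ?_⟩, fun β w _ => ?_⟩
    · simp [treeSum, treeScale]
    · simp [treeSum]
    · simp [treeSum]
  | succ d ih => exact h.treeLaw_succ hl (ih (l + 1) (by omega))

end Tree

/-! ### Expected logarithms from small moments -/

section Log

variable {Ω : Type*} [MeasurableSpace Ω] {P : Measure Ω}

theorem ae_ne_zero_of_lintegral_inv {X : Ω → ℝ≥0∞} (hX : Measurable X)
    (hinv : ∫⁻ ω, (X ω)⁻¹ ∂P < ∞) : ∀ᵐ ω ∂P, X ω ≠ 0 := by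
  filter_upwards [ae_lt_top hX.inv hinv.ne] with ω hω
  exact ENNReal.inv_ne_top.1 hω.ne

theorem ae_ne_top_of_lintegral_rpow {X : Ω → ℝ≥0∞} (hX : Measurable X) {p : ℝ} (hp : 0 < p)
    (h : ∫⁻ ω, X ω ^ p ∂P ≠ ∞) : ∀ᵐ ω ∂P, X ω ≠ ∞ := by
  filter_upwards [ae_lt_top (hX.pow_const p) h] with ω hω hX
  simp [hX, ENNReal.top_rpow_of_pos hp] at hω

theorem exp_mul_log_toReal {x : ℝ≥0∞} (h0 : x ≠ 0) (ht : x ≠ ∞) (p : ℝ) :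
    Real.exp (p * Real.log x.toReal) = (x ^ p).toReal := by
  rw [← ENNReal.toReal_rpow, Real.rpow_def_of_pos (ENNReal.toReal_pos h0 ht), mul_comm]

theorem integrable_exp_mul_log {X : Ω → ℝ≥0∞} (hX : Measurable X) (h0 : ∀ᵐ ω ∂P, X ω ≠ 0)
    (ht : ∀ᵐ ω ∂P, X ω ≠ ∞) {p : ℝ} (hp : ∫⁻ ω, X ω ^ p ∂P ≠ ∞) :
    Integrable (fun ω => Real.exp (p * Real.log (X ω).toReal)) P := by
  refine (integrable_toReal_of_lintegral_ne_top (hX.pow_const p).aemeasurable hp).congr ?_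
  filter_upwards [h0, ht] with ω h0 ht using (exp_mul_log_toReal h0 ht p).symm

theorem mgf_log {X : Ω → ℝ≥0∞} (hX : Measurable X) (h0 : ∀ᵐ ω ∂P, X ω ≠ 0)
    (ht : ∀ᵐ ω ∂P, X ω ≠ ∞) {p : ℝ} (hp : ∫⁻ ω, X ω ^ p ∂P ≠ ∞) :
    mgf (fun ω => Real.log (X ω).toReal) P p = (∫⁻ ω, X ω ^ p ∂P).toReal := by
  rw [mgf, ← integral_toReal (hX.pow_const p).aemeasurable
    (ae_lt_top (hX.pow_const p) hp)]
  refine integral_congr_ae ?_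
  filter_upwards [h0, ht] with ω h0 ht using exp_mul_log_toReal h0 ht p

/-- The exponents for which `X` has a finite moment form an interval; it contains `-1` and `p`,
hence a neighbourhood of `0`. -/
theorem zero_mem_interior_integrableExpSet_log [IsFiniteMeasure P] {X : Ω → ℝ≥0∞}
    (hX : Measurable X) {p : ℝ} (hp : 0 < p) (h : ∫⁻ ω, X ω ^ p ∂P ≠ ∞)
    (hinv : ∫⁻ ω, (X ω)⁻¹ ∂P < ∞) :
    0 ∈ interior (integrableExpSet (fun ω => Real.log (X ω).toReal) P) := by
  have h0 := ae_ne_zero_of_lintegral_inv hX hinv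
  have ht := ae_ne_top_of_lintegral_rpow hX hp h
  have h1 : (-1 : ℝ) ∈ integrableExpSet (fun ω => Real.log (X ω).toReal) P :=
    integrable_exp_mul_log hX h0 ht (by simpa [ENNReal.rpow_neg_one] using hinv.ne)
  have h2 : p ∈ integrableExpSet (fun ω => Real.log (X ω).toReal) P :=
    integrable_exp_mul_log hX h0 ht h
  have hsub := (convex_integrableExpSet (X := fun ω => Real.log (X ω).toReal)
    (μ := P)).ordConnected.out h1 h2
  refine mem_interior.2 ⟨Ioo (-1) p, Ioo_subset_Icc_self.trans hsub, isOpen_Ioo, ?_⟩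
  constructor <;> linarith

/-- If the small moments of `X` are those of `c Y`, then `𝔼 log X = log c + 𝔼 log Y`. -/
theorem integral_log_of_moments [IsProbabilityMeasure P] {X Y : Ω → ℝ≥0∞} (hX : Measurable X)
    (hY : Measurable Y) {p₀ c : ℝ} (hp₀ : 0 < p₀) (hc : 0 < c)
    (hYt : ∀ p, 0 < p → p ≤ p₀ → ∫⁻ ω, Y ω ^ p ∂P ≠ ∞)
    (hXY : ∀ p, 0 < p → p ≤ p₀ → ∫⁻ ω, X ω ^ p ∂P = ENNReal.ofReal (c ^ p) * ∫⁻ ω, Y ω ^ p ∂P)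
    (hXinv : ∫⁻ ω, (X ω)⁻¹ ∂P < ∞) (hYinv : ∫⁻ ω, (Y ω)⁻¹ ∂P < ∞) :
    ∫ ω, Real.log (X ω).toReal ∂P = Real.log c + ∫ ω, Real.log (Y ω).toReal ∂P := by
  have hXt : ∀ p, 0 < p → p ≤ p₀ → ∫⁻ ω, X ω ^ p ∂P ≠ ∞ := fun p h1 h2 => by
    rw [hXY p h1 h2]; exact ENNReal.mul_ne_top ENNReal.ofReal_ne_top (hYt p h1 h2)
  have hX0 := ae_ne_zero_of_lintegral_inv hX hXinv
  have hY0 := ae_ne_zero_of_lintegral_inv hY hYinv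
  have hXf := ae_ne_top_of_lintegral_rpow hX hp₀ (hXt p₀ hp₀ le_rfl)
  have hYf := ae_ne_top_of_lintegral_rpow hY hp₀ (hYt p₀ hp₀ le_rfl)
  have hXd := hasDerivAt_mgf
    (zero_mem_interior_integrableExpSet_log hX hp₀ (hXt p₀ hp₀ le_rfl) hXinv)
  have hYd := hasDerivAt_mgf
    (zero_mem_interior_integrableExpSet_log hY hp₀ (hYt p₀ hp₀ le_rfl) hYinv)
  simp only [zero_mul, Real.exp_zero, mul_one] at hXd hYd
  have hcd : HasDerivAt (fun p : ℝ => c ^ p) (Real.log c) 0 := by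
    simpa using (Real.hasStrictDerivAt_const_rpow hc 0).hasDerivAt
  have hprod := hcd.mul hYd
  simp only [mgf_zero, mul_one, Real.rpow_zero, one_mul] at hprod
  -- The moments are related only for exponents in `[0, p₀]`, so the derivatives at `0` are compared
  -- from the right. This suffices, since both functions are differentiable there.
  have huniq : UniqueDiffWithinAt ℝ (Icc 0 p₀) (0 : ℝ) :=
    uniqueDiffOn_Icc hp₀ 0 ⟨le_rfl, hp₀.le⟩
  refine huniq.eq_deriv _ hXd.hasDerivWithinAt (hprod.hasDerivWithinAt.congr_of_mem ?_
    ⟨le_rfl, hp₀.le⟩)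
  rintro p ⟨hp0, hp1⟩
  rcases hp0.eq_or_lt with rfl | hp0
  · simp
  · rw [mgf_log hX hX0 hXf (hXt p hp0 hp1), hXY p hp0 hp1, ENNReal.toReal_mul,
      ENNReal.toReal_ofReal (Real.rpow_nonneg hc.le _), Pi.mul_apply,
      mgf_log hY hY0 hYf (hYt p hp0 hp1)]

end Log

/-! ### Expected logarithms of tree sums, and their expansion over the leaves -/

section Tree

variable {Ω ι : Type*} [mΩ : MeasurableSpace Ω]
  {k : ℕ} {m : ℕ → ℝ} {v : ℕ → ℝ≥0} {Z : List ℕ → ℕ → Ω → ℝ} {H : List ℕ → Ω → ℝ}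
  {σ : ι → MeasurableSpace Ω} {pos : ι → List ℕ ⊕ List ℕ} {P : Measure Ω}

namespace IsTreeField

/-- The constant `b` of `TreeLaw` is shared by all `β` and equals the moment at `β = 0`, where the
scale is one. The range `p ≤ p₀` is uniform in `β`. -/
theorem exists_moment (h : IsTreeField k m v Z H σ pos P) :
    ∃ p₀ : ℝ, 0 < p₀ ∧ ∀ p, 0 < p → p ≤ p₀ → ∀ β,
      ∫⁻ ω, treeSum Z H β k [] ω ^ p ∂P ≠ ∞ ∧ ∫⁻ ω, treeSum Z H β k [] ω ^ p ∂P =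
        ENNReal.ofReal (treeScale m v β k 0 ^ p) * ∫⁻ ω, treeSum Z H 0 k [] ω ^ p ∂P := by
  have hlaw := h.treeLaw k 0 (zero_add k)
  obtain ⟨p₀, hp₀, hlt⟩ : ∃ p₀ : ℝ, 0 < p₀ ∧ ∀ p, p ≤ p₀ → (k = 0 ∨ p < m 0) := by
    rcases k.eq_zero_or_pos with hk | hk
    · exact ⟨1, one_pos, fun p _ => Or.inl hk⟩
    · have := h.param_pos 0 hk
      exact ⟨m 0 / 2, by positivity, fun p hp => Or.inr (by linarith)⟩
  refine ⟨p₀, hp₀, fun p hp hpp β => ?_⟩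
  obtain ⟨b, _, hbt, hb⟩ := hlaw.moment p hp (hlt p hpp)
  have h0 := hb 0 [] rfl
  rw [treeScale_zero, Real.one_rpow, ENNReal.ofReal_one, one_mul] at h0
  rw [h0, hb β [] rfl]
  exact ⟨ENNReal.mul_ne_top ENNReal.ofReal_ne_top hbt, rfl⟩

theorem ae_treeSum (h : IsTreeField k m v Z H σ pos P) (β : ℝ) :
    ∀ᵐ ω ∂P, treeSum Z H β k [] ω ≠ 0 ∧ treeSum Z H β k [] ω ≠ ∞ := by
  obtain ⟨p₀, hp₀, hmom⟩ := h.exists_moment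
  have hm := h.measurable_treeSum β k []
  exact (ae_ne_zero_of_lintegral_inv hm ((h.treeLaw k 0 (zero_add k)).inv β [] rfl)).and
    (ae_ne_top_of_lintegral_rpow hm hp₀ (hmom p₀ hp₀ le_rfl β).1)

theorem integrable_log_treeSum (h : IsTreeField k m v Z H σ pos P) (β : ℝ) :
    Integrable (fun ω => Real.log (treeSum Z H β k [] ω).toReal) P := by
  have := h.isProbabilityMeasure
  obtain ⟨p₀, hp₀, hmom⟩ := h.exists_moment
  exact integrable_of_mem_interior_integrableExpSet
    (zero_mem_interior_integrableExpSet_log (h.measurable_treeSum β k []) hp₀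
      (hmom p₀ hp₀ le_rfl β).1 ((h.treeLaw k 0 (zero_add k)).inv β [] rfl))

theorem integral_log_treeSum (h : IsTreeField k m v Z H σ pos P) (β : ℝ) :
    ∫ ω, Real.log (treeSum Z H β k [] ω).toReal ∂P =
      β ^ 2 / 2 * (∑ i ∈ Finset.range k, m i * v (i + 1)) +
        ∫ ω, Real.log (treeSum Z H 0 k [] ω).toReal ∂P := by
  have := h.isProbabilityMeasure
  obtain ⟨p₀, hp₀, hmom⟩ := h.exists_moment
  have hlaw := h.treeLaw k 0 (zero_add k)
  rw [integral_log_of_moments (h.measurable_treeSum β k []) (h.measurable_treeSum 0 k []) hp₀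
    (treeScale_pos m v β k 0) (fun p h1 h2 => (hmom p h1 h2 0).1)
    (fun p h1 h2 => (hmom p h1 h2 β).2) (hlaw.inv β [] rfl) (hlaw.inv 0 [] rfl), log_treeScale]
  simp

end IsTreeField

omit mΩ in
/-- The tree sum is the sum over the leaves of the products of the weights along the branches. -/
theorem tsum_prod_eq_treeSum (β : ℝ) (d : ℕ) (w : List ℕ) (ω : Ω) :
    ∑' α : Fin d → ℕ, ∏ i : Fin d, (ENNReal.ofReal (Z (w ++ (List.ofFn α).take i) (α i) ω) *
      ENNReal.ofReal (Real.exp (β * H (w ++ (List.ofFn α).take (i + 1)) ω))) =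
        treeSum Z H β d w ω := by
  induction d generalizing w with
  | zero => simp [treeSum]
  | succ d ih =>
    rw [← (Fin.consEquiv fun _ => ℕ).tsum_eq, ENNReal.tsum_prod', treeSum]
    congr 1
    ext j
    rw [← ih, ← ENNReal.tsum_mul_left, ← ENNReal.tsum_mul_left]
    congr 1
    ext α
    rw [Fin.prod_univ_succ, ← mul_assoc]
    simp [Fin.consEquiv, List.ofFn_succ]

end Tree

/-- A finite set of indices splits into its two sides: independence of the two joins separates them,
and independence within each family does the rest. -/
theorem iIndep_sumElim {Ω ι κ : Type*} {mΩ : MeasurableSpace Ω} {P : Measure Ω}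
    {σ : ι → MeasurableSpace Ω} {τ : κ → MeasurableSpace Ω} (hσ : iIndep σ P) (hτ : iIndep τ P)
    (h : Indep (⨆ i, σ i) (⨆ j, τ j) P) : iIndep (Sum.elim σ τ) P := by
  rw [iIndep_iff]
  intro s f hf
  have hl : ∀ i ∈ s.toLeft, MeasurableSet[σ i] (f (Sum.inl i)) := fun i hi =>
    hf _ (Finset.mem_toLeft.1 hi)
  have hr : ∀ j ∈ s.toRight, MeasurableSet[τ j] (f (Sum.inr j)) := fun j hj =>
    hf _ (Finset.mem_toRight.1 hj)
  have hset : ⋂ i ∈ s, f i =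
      (⋂ i ∈ s.toLeft, f (Sum.inl i)) ∩ ⋂ j ∈ s.toRight, f (Sum.inr j) := by
    ext ω
    simp
  have hprod : ∏ i ∈ s, P (f i) =
      (∏ i ∈ s.toLeft, P (f (Sum.inl i))) * ∏ j ∈ s.toRight, P (f (Sum.inr j)) := by
    conv_lhs => rw [← Finset.toLeft_disjSum_toRight (u := s)]
    rw [Finset.prod_disjSum]
  rw [hset, hprod, ← (iIndep_iff _ _).1 hσ _ hl, ← (iIndep_iff _ _).1 hτ _ hr]
  refine (Indep_iff _ _ _).1 h _ _ ?_ ?_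
  · exact Finset.measurableSet_biInter _ fun i hi => le_iSup σ i _ (hl i hi)
  · exact Finset.measurableSet_biInter _ fun j hj => le_iSup τ j _ (hr j hj)

/-! ### Levels, overlaps and words -/

namespace AtomicMeasure

variable {k : ℕ} (x : AtomicMeasure k)

/-- The positions `0, q_1, …, q_k, q_{k+1} = 1`. -/
def level : ℕ → ℝ
  | 0 => 0
  -- The added position `0` shifts the index by one against `q`; the minimum makes the sequence
  -- constant after the last atom.
  | l + 1 => x.q ⟨min l k, by omega⟩

theorem level_succ (l : Fin (k + 1)) : x.level (l + 1) = x.q l := by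
  rw [level]
  congr 1
  exact Fin.ext (min_eq_left (Nat.lt_succ_iff.1 l.2))

theorem level_last : x.level (k + 1) = 1 := by
  rw [← x.q_last, ← x.level_succ]
  rfl

theorem level_mono : Monotone x.level := by
  refine monotone_nat_of_le_succ fun l => ?_
  cases l with
  | zero => exact x.q_nonneg.trans (x.q_strictMono.monotone (Fin.zero_le _))
  | succ l => exact x.q_strictMono.monotone (Fin.mk_le_mk.2 (by omega))

theorem level_mem (l : ℕ) : x.level l ∈ Icc (0 : ℝ) 1 := by
  refine ⟨x.level_mono (zero_le (a := l)), ?_⟩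
  cases l with
  | zero => exact zero_le_one
  | succ l =>
    rw [← x.q_last]
    exact x.q_strictMono.monotone (Fin.le_last _)

/-- The positions as elements of `[0,1]`. -/
def point (l : ℕ) : Icc (0 : ℝ) 1 := ⟨x.level l, x.level_mem l⟩

theorem overlap_le_one (α α' : Fin k → ℕ) : overlap x α α' ≤ 1 := by
  rw [← x.q_last]
  exact Finset.sup'_le _ _ fun l _ => x.q_strictMono.monotone (Fin.le_last l)

theorem level_le_overlap {α α' : Fin k → ℕ} (l : Fin (k + 1))
    (h : ∀ i : Fin k, (i : ℕ) < l → α i = α' i) : x.level (l + 1) ≤ overlap x α α' := by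
  rw [x.level_succ]
  exact Finset.le_sup' x.q (by simpa [commonLevels] using h)

theorem overlap_le_level {α α' : Fin k → ℕ} {l : ℕ} {i : Fin k} (hi : (i : ℕ) < l)
    (h : α i ≠ α' i) : overlap x α α' ≤ x.level l := by
  refine Finset.sup'_le _ _ fun j hj => ?_
  rw [← x.level_succ]
  refine x.level_mono ?_
  have hj : ∀ i : Fin k, (i : ℕ) < j → α i = α' i := by simpa [commonLevels] using hj
  by_contra hlt
  exact h (hj i (by omega))

theorem overlap_self (α : Fin k → ℕ) : overlap x α α = 1 := by
  refine le_antisymm (x.overlap_le_one α α) ?_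
  rw [← x.level_last]
  exact x.level_le_overlap (Fin.last k) fun _ _ => rfl

end AtomicMeasure

section Words

variable {k : ℕ}

/-- A node of the cascade as a word. -/
def Node.word (a : Node k) : List ℕ := List.ofFn a.2

theorem Node.length_word (a : Node k) : a.word.length = a.1 := List.length_ofFn

theorem Node.word_injective : Function.Injective (Node.word (k := k)) := by
  rintro ⟨l, f⟩ ⟨l', f'⟩ h
  have hl := congrArg List.length h
  rw [Node.length_word, Node.length_word] at hl
  obtain rfl : l = l' := Fin.ext hl
  exact congrArg (Sigma.mk l) (List.ofFn_injective h)

theorem Node.exists_word {w : List ℕ} (hw : w.length < k) : ∃ a : Node k, a.word = w :=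
  ⟨⟨⟨w.length, hw⟩, w.get⟩, List.ofFn_get w⟩

/-- The truncation of `α` at the level `l`, for `0 ≤ l ≤ k`. -/
def prefixNode (α : Fin k → ℕ) (l : Fin (k + 1)) : Node (k + 1) :=
  ⟨l, fun i => α (Fin.castLE (Nat.lt_succ_iff.1 l.isLt) i)⟩

theorem word_trunc (α : Fin k → ℕ) (l : Fin k) : (trunc α l).word = (List.ofFn α).take l := by
  refine List.ext_getElem ?_ fun i h1 h2 => ?_
  · rw [Node.length_word]
    simp [trunc, l.isLt.le]
  · simp [Node.word, trunc]

theorem word_prefixNode (α : Fin k → ℕ) (l : Fin (k + 1)) :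
    (prefixNode α l).word = (List.ofFn α).take l := by
  refine List.ext_getElem ?_ fun i h1 h2 => ?_
  · rw [Node.length_word]
    simp [prefixNode, Nat.lt_succ_iff.1 l.isLt]
  · simp [Node.word, prefixNode]

/-- The leaf which extends a word by zeros. -/
def Node.leaf (a : Node (k + 1)) (i : Fin k) : ℕ := if h : (i : ℕ) < a.1 then a.2 ⟨i, h⟩ else 0

theorem leaf_prefixNode (α : Fin k → ℕ) (l : Fin (k + 1)) (i : Fin k) (hi : (i : ℕ) < l) :
    (prefixNode α l).leaf i = α i := by
  rw [Node.leaf, dif_pos (show (i : ℕ) < (prefixNode α l).1 from hi)]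
  rfl

theorem Node.exists_leaf_ne {l : Fin (k + 1)} {f f' : Fin l → ℕ} (h : f ≠ f') :
    ∃ i : Fin k, (i : ℕ) < l ∧
      Node.leaf (⟨l, f⟩ : Node (k + 1)) i ≠ Node.leaf (⟨l, f'⟩ : Node (k + 1)) i := by
  obtain ⟨i, hi⟩ := Function.ne_iff.1 h
  have hik : (i : ℕ) < k := by omega
  refine ⟨⟨i, hik⟩, i.isLt, ?_⟩
  simpa [Node.leaf] using hi

end Words

/-! ### The Gaussian field as a sum of independent increments -/

section Field

variable {Ω : Type*} [mΩ : MeasurableSpace Ω] {P : Measure Ω} {k : ℕ} {x : AtomicMeasure k}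
  {g : ℝ → ℝ} {ζ : Node k → ℕ → Ω → ℝ} {κ : (Fin k → ℕ) × Icc (0 : ℝ) 1 → Ω → ℝ}

/-- The increment of the field along the edge above a node. -/
def increment (x : AtomicMeasure k) (κ : (Fin k → ℕ) × Icc (0 : ℝ) 1 → Ω → ℝ)
    (a : Node (k + 1)) (ω : Ω) : ℝ :=
  κ (a.leaf, x.point (a.1 + 1)) ω - κ (a.leaf, x.point a.1) ω

/-- The increment of `g` at a level. -/
def levelVar (x : AtomicMeasure k) (g : ℝ → ℝ) (l : ℕ) : ℝ≥0 :=
  (g (x.level (l + 1)) - g (x.level l)).toNNReal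

namespace IsGaussianField

theorem memLp (h : IsGaussianField x g κ P) (t) : MemLp (κ t) 2 P :=
  (h.gaussian.hasGaussianLaw_eval t).memLp_two

theorem integrable (h : IsGaussianField x g κ P) (t) : Integrable (κ t) P :=
  (h.gaussian.hasGaussianLaw_eval t).integrable

theorem isGaussianProcess_increment (h : IsGaussianField x g κ P) :
    IsGaussianProcess (increment x κ) P := by
  classical
  refine IsGaussianProcess.of_isGaussianProcess h.gaussian fun a =>
    ⟨{(a.leaf, x.point (a.1 + 1)), (a.leaf, x.point a.1)},
      ContinuousLinearMap.proj ⟨(a.leaf, x.point (a.1 + 1)), by simp⟩ -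
        ContinuousLinearMap.proj ⟨(a.leaf, x.point a.1), by simp⟩, fun ω => rfl⟩

theorem measurable_increment (h : IsGaussianField x g κ P) (a : Node (k + 1)) :
    Measurable (increment x κ a) := (h.measurable _).sub (h.measurable _)

variable [IsProbabilityMeasure P]

theorem ae_eq_zero (hg : IsCovFunction g) (h : IsGaussianField x g κ P) (α : Fin k → ℕ) :
    ∀ᵐ ω ∂P, κ (α, x.point 0) ω = 0 := by
  have hv : variance (κ (α, x.point 0)) P = 0 := by
    rw [← covariance_self (h.measurable _).aemeasurable, h.cov, x.overlap_self]
    simp [AtomicMeasure.point, AtomicMeasure.level, hg.map_zero]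
  have := ae_eq_integral_of_variance_eq_zero (h.memLp _) hv
  rwa [h.centered] at this

/-- The difference is centered, and its variance is `g - 2g + g = 0` at the common level. So an
increment does not depend, almost surely, on the leaf chosen below its node. -/
theorem ae_eq_of_level_le (h : IsGaussianField x g κ P) {α α' : Fin k → ℕ} {l : ℕ}
    (hl : x.level l ≤ overlap x α α') :
    ∀ᵐ ω ∂P, κ (α, x.point l) ω = κ (α', x.point l) ω := by
  have hv : variance (fun ω => κ (α, x.point l) ω - κ (α', x.point l) ω) P = 0 := by
    have h1 := (x.level_mem l).2
    rw [variance_fun_sub (h.memLp _) (h.memLp _), ← covariance_self (h.measurable _).aemeasurable,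
      ← covariance_self (h.measurable _).aemeasurable, h.cov, h.cov, h.cov, x.overlap_self,
      x.overlap_self]
    simp only [AtomicMeasure.point, min_self, min_eq_left h1, min_eq_left hl]
    ring
  have := ae_eq_integral_of_variance_eq_zero ((h.memLp _).sub (h.memLp _)) hv
  rw [integral_sub' (h.integrable _) (h.integrable _), h.centered, h.centered, sub_zero] at this
  filter_upwards [this] with ω hω using sub_eq_zero.1 hω

/-- The field at `1` is the sum of the increments along the branch. -/
theorem ae_eq_sum_increment (hg : IsCovFunction g) (h : IsGaussianField x g κ P)
    (α : Fin k → ℕ) :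
    ∀ᵐ ω ∂P, κ (α, 1) ω = ∑ l : Fin (k + 1), increment x κ (prefixNode α l) ω := by
  have hle : ∀ l : Fin (k + 1), x.level (l + 1) ≤ overlap x (prefixNode α l).leaf α :=
    fun l => x.level_le_overlap l fun i hi => leaf_prefixNode α l i hi
  have h1 : ∀ᵐ ω ∂P, ∀ l : Fin (k + 1),
      κ ((prefixNode α l).leaf, x.point (l + 1)) ω = κ (α, x.point (l + 1)) ω :=
    ae_all_iff.2 fun l => h.ae_eq_of_level_le (hle l)
  have h2 : ∀ᵐ ω ∂P, ∀ l : Fin (k + 1),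
      κ ((prefixNode α l).leaf, x.point l) ω = κ (α, x.point l) ω :=
    ae_all_iff.2 fun l => h.ae_eq_of_level_le ((x.level_mono (Nat.le_succ _)).trans (hle l))
  filter_upwards [h1, h2, h.ae_eq_zero hg α] with ω h1 h2 h0
  have hsum : ∀ l : Fin (k + 1), increment x κ (prefixNode α l) ω =
      (fun n : ℕ => κ (α, x.point (n + 1)) ω - κ (α, x.point n) ω) l := fun l => by
    exact congrArg₂ (· - ·) (h1 l) (h2 l)
  rw [Finset.sum_congr rfl fun l _ => hsum l, Fin.sum_univ_eq_sum_range
    (fun n : ℕ => κ (α, x.point (n + 1)) ω - κ (α, x.point n) ω),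
    Finset.sum_range_sub (fun n => κ (α, x.point n) ω), h0, sub_zero]
  rw [show x.point (k + 1) = 1 from Subtype.ext x.level_last]

theorem covariance_increment (h : IsGaussianField x g κ P) (a b : Node (k + 1)) :
    covariance (increment x κ a) (increment x κ b) P =
      g (min (min (x.level (a.1 + 1)) (x.level (b.1 + 1))) (overlap x a.leaf b.leaf)) -
      g (min (min (x.level (a.1 + 1)) (x.level b.1)) (overlap x a.leaf b.leaf)) -
      g (min (min (x.level a.1) (x.level (b.1 + 1))) (overlap x a.leaf b.leaf)) +
      g (min (min (x.level a.1) (x.level b.1)) (overlap x a.leaf b.leaf)) := by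
  unfold increment
  rw [covariance_fun_sub_fun_sub (h.memLp _) (h.memLp _) (h.memLp _) (h.memLp _),
    h.cov, h.cov, h.cov, h.cov]
  rfl

theorem covariance_increment_eq_zero (h : IsGaussianField x g κ P) {a b : Node (k + 1)}
    (hab : a ≠ b) : covariance (increment x κ a) (increment x κ b) P = 0 := by
  -- At different levels the lower increment ends before the upper one starts, so the minima do not
  -- see the endpoints of the upper one and the four terms cancel in pairs.
  have hlt : ∀ a b : Node (k + 1), a.1 < b.1 →
      covariance (increment x κ a) (increment x κ b) P = 0 := by
    intro a b hlt
    have h0 := x.level_mono (Nat.le_succ (a.1 : ℕ))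
    have h1 := x.level_mono (show (a.1 : ℕ) + 1 ≤ b.1 from hlt)
    have h2 := x.level_mono (Nat.le_succ (b.1 : ℕ))
    rw [h.covariance_increment, min_eq_left (h1.trans h2), min_eq_left h1,
      min_eq_left (h0.trans (h1.trans h2)), min_eq_left (h0.trans h1)]
    ring
  rcases lt_trichotomy a.1 b.1 with hl | hl | hl
  · exact hlt a b hl
  · obtain ⟨l, f⟩ := a
    obtain ⟨l', f'⟩ := b
    obtain rfl : l = l' := hl
    -- At the same level the two branches have already separated: the overlap lies below all the
    -- endpoints, and all four terms are `g` of the overlap.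
    have hff : f ≠ f' := fun h => hab (by rw [h])
    obtain ⟨i, hi, hne⟩ := Node.exists_leaf_ne hff
    have ho := x.overlap_le_level hi hne
    have ho' := ho.trans (x.level_mono (Nat.le_succ _))
    rw [h.covariance_increment, min_eq_right (le_min ho' ho'), min_eq_right (le_min ho' ho),
      min_eq_right (le_min ho ho'), min_eq_right (le_min ho ho)]
    ring
  · rw [covariance_comm]
    exact hlt b a hl

theorem variance_increment (h : IsGaussianField x g κ P) (a : Node (k + 1)) :
    variance (increment x κ a) P = g (x.level (a.1 + 1)) - g (x.level a.1) := by
  have hm : Measurable (increment x κ a) := (h.measurable _).sub (h.measurable _)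
  have h0 := x.level_mono (Nat.le_succ (a.1 : ℕ))
  rw [← covariance_self hm.aemeasurable, h.covariance_increment, x.overlap_self, min_self, min_self,
    min_eq_right h0, min_eq_left h0, min_eq_left (x.level_mem _).2, min_eq_left (x.level_mem _).2]
  ring

theorem hasLaw_increment (h : IsGaussianField x g κ P) (a : Node (k + 1)) :
    HasLaw (increment x κ a) (gaussianReal 0 (levelVar x g a.1)) P := by
  refine ⟨(h.measurable_increment a).aemeasurable, ?_⟩
  rw [(h.isGaussianProcess_increment.hasGaussianLaw_eval a).map_eq_gaussianReal,
    h.variance_increment, levelVar]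
  congr 1
  unfold increment
  rw [integral_sub (h.integrable _) (h.integrable _), h.centered, h.centered, sub_zero]

theorem iIndepFun_increment (h : IsGaussianField x g κ P) : iIndepFun (increment x κ) P := by
  -- Each increment is viewed as a process over `Unit`, to fit the independence criterion for
  -- uncorrelated, jointly Gaussian processes.
  have h1 : IsGaussianProcess
      (fun (p : (_ : Node (k + 1)) × Unit) ω => increment x κ p.1 ω) P :=
    h.isGaussianProcess_increment.comp_right Sigma.fst
  have h2 := h1.iIndepFun_of_covariance_eq_zero (X := fun a (_ : Unit) => increment x κ a)
    (fun a _ => (h.measurable_increment a).aemeasurable)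
    fun a b hab _ _ => h.covariance_increment_eq_zero hab
  exact h2.comp (fun _ y => y ()) fun _ => measurable_pi_apply ()

end IsGaussianField

/-- The REMs of the cascade, indexed by words. -/
noncomputable def wordRem (ζ : Node k → ℕ → Ω → ℝ) : List ℕ → ℕ → Ω → ℝ :=
  Function.extend Node.word ζ fun _ _ _ => 0

/-- The increments of the field, indexed by words. -/
noncomputable def wordIncrement (x : AtomicMeasure k) (κ : (Fin k → ℕ) × Icc (0 : ℝ) 1 → Ω → ℝ) :
    List ℕ → Ω → ℝ :=
  Function.extend Node.word (increment x κ) fun _ _ => 0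

/-- The parameters of the cascade. -/
noncomputable def levelParam (x : AtomicMeasure k) (l : ℕ) : ℝ := x.df (x.level (l + 1))

omit mΩ in
theorem wordRem_word (ζ : Node k → ℕ → Ω → ℝ) (a : Node k) : wordRem ζ a.word = ζ a :=
  Node.word_injective.extend_apply _ _ _

omit mΩ in
theorem wordIncrement_word (a : Node (k + 1)) :
    wordIncrement x κ a.word = increment x κ a :=
  Node.word_injective.extend_apply _ _ _

namespace AtomicMeasure

variable (x)

theorem df_add_le {r : ℝ} {l : Fin (k + 1)} (hr : r < x.q l) :
    x.df r + x.law.real {x.q l} ≤ x.df (x.q l) := by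
  have := x.isProb
  rw [df, df, cdf_eq_real, cdf_eq_real, ← measureReal_union (by simpa using hr)
    (measurableSet_singleton _)]
  exact measureReal_mono (union_subset (Iic_subset_Iic.2 hr.le) (by simp))

theorem df_nonneg (r : ℝ) : 0 ≤ x.df r := cdf_nonneg _ _

theorem df_le_one (r : ℝ) : x.df r ≤ 1 := cdf_le_one _ _

theorem df_lt {r : ℝ} {l : Fin (k + 1)} (hr : r < x.q l) : x.df r < x.df (x.q l) := by
  have := x.isProb
  have h : 0 < x.law.real {x.q l} := ENNReal.toReal_pos (x.atom_pos l).ne' (measure_ne_top _ _)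
  linarith [x.df_add_le hr]

theorem level_lt {l : ℕ} (hl : l < k) : x.level (l + 1) < x.level (l + 1 + 1) := by
  have h1 := x.level_succ ⟨l, by omega⟩
  have h2 := x.level_succ ⟨l + 1, by omega⟩
  dsimp only at h1 h2
  rw [h1, h2]
  exact x.q_strictMono (Fin.mk_lt_mk.2 l.lt_succ_self)

theorem levelParam_lt {l : ℕ} (hl : l < k) : levelParam x l < levelParam x (l + 1) := by
  have h := x.level_lt hl
  have h2 := x.level_succ ⟨l + 1, by omega⟩
  dsimp only at h2
  rw [levelParam, levelParam, h2]
  rw [h2] at h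
  exact x.df_lt h

theorem levelParam_lt_one {l : ℕ} (hl : l < k) : levelParam x l < 1 :=
  (x.levelParam_lt hl).trans_le (x.df_le_one _)

theorem levelParam_pos {l : ℕ} (hl : l < k) : 0 < levelParam x l := by
  have h2 := x.level_succ ⟨l, by omega⟩
  dsimp only at h2
  rw [levelParam, h2]
  -- Any point to the left of the atom would do; the jump at the atom makes the value positive even
  -- when the atom is at `0`.
  exact (x.df_nonneg _).trans_lt (x.df_lt (sub_one_lt _))

end AtomicMeasure

/-- The σ-algebras of the REMs and of the increments of the field. -/
abbrev nodeAlgebra (x : AtomicMeasure k) (ζ : Node k → ℕ → Ω → ℝ)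
    (κ : (Fin k → ℕ) × Icc (0 : ℝ) 1 → Ω → ℝ) : Node k ⊕ Node (k + 1) → MeasurableSpace Ω :=
  Sum.elim (fun a => MeasurableSpace.comap (fun ω j => ζ a j ω) inferInstance)
    fun a => MeasurableSpace.comap (increment x κ a) inferInstance

/-- The Gaussian nodes reach one level deeper than the REMs, since leaves carry an increment but no
further points. -/
theorem IsGREMWithField.isTreeField [IsProbabilityMeasure P] (h : IsGREMWithField x g ζ κ P) :
    IsTreeField k (levelParam x) (levelVar x g) (wordRem ζ) (wordIncrement x κ)
      (nodeAlgebra x ζ κ) (Sum.map Node.word Node.word) P where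
  le i := by
    rcases i with a | a
    · exact (measurable_pi_lambda _ (h.cascade.isREM a).measurable).comap_le
    · exact (h.field.measurable_increment a).comap_le
  indep := by
    refine iIndep_sumElim ((iIndepFun_iff_iIndep _ _ _).1 h.cascade.indep)
      ((iIndepFun_iff_iIndep _ _ _).1 h.field.iIndepFun_increment) ?_
    refine indep_of_indep_of_le ((IndepFun_iff_Indep _ _ _).1 h.indep) ?_ ?_
    · refine iSup_le fun a => Measurable.comap_le ?_
      exact (measurable_pi_apply a).comp
        (comap_measurable (fun (ω : Ω) (a : Node k) (j : ℕ) => ζ a j ω))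
    · refine iSup_le fun a => Measurable.comap_le ?_
      have hm : Measurable fun y : (Fin k → ℕ) × Icc (0 : ℝ) 1 → ℝ =>
          y (a.leaf, x.point (a.1 + 1)) - y (a.leaf, x.point a.1) :=
        (measurable_pi_apply _).sub (measurable_pi_apply _)
      exact hm.comp (comap_measurable (fun (ω : Ω) t => κ t ω))
  measurable_rem w j := by
    by_cases hw : ∃ a : Node k, a.word = w
    · obtain ⟨a, rfl⟩ := hw
      rw [wordRem_word]
      have h1 : Measurable[nodeAlgebra x ζ κ (Sum.inl a)] (ζ a j) :=
        (measurable_pi_apply j).comp (comap_measurable (fun (ω : Ω) j => ζ a j ω))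
      exact h1.mono (le_biSup (nodeAlgebra x ζ κ)
        (i := Sum.inl a) (show Sum.map Node.word Node.word (Sum.inl a) = _ from rfl)) le_rfl
    -- A word that is no node has an empty block, whose σ-algebra is trivial; a constant is
    -- measurable for it.
    · rw [wordRem, Function.extend_apply' _ _ _ hw]
      exact measurable_const
  measurable_gauss w := by
    by_cases hw : ∃ a : Node (k + 1), a.word = w
    · obtain ⟨a, rfl⟩ := hw
      rw [wordIncrement_word]
      have h1 : Measurable[nodeAlgebra x ζ κ (Sum.inr a)] (increment x κ a) :=
        comap_measurable _
      exact h1.mono (le_biSup (nodeAlgebra x ζ κ)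
        (i := Sum.inr a) (show Sum.map Node.word Node.word (Sum.inr a) = _ from rfl)) le_rfl
    · rw [wordIncrement, Function.extend_apply' _ _ _ hw]
      exact measurable_const
  isREM w hw := by
    obtain ⟨a, rfl⟩ := Node.exists_word hw
    have := h.cascade.isREM a
    rwa [← x.level_succ, Fin.val_castSucc, ← a.length_word, ← wordRem_word ζ a] at this
  hasLaw w hw := by
    obtain ⟨a, rfl⟩ := Node.exists_word (k := k + 1) (Nat.lt_succ_iff.2 hw)
    rw [a.length_word, wordIncrement_word]
    exact h.field.hasLaw_increment a
  param_pos l hl := x.levelParam_pos hl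
  param_lt_one l hl := x.levelParam_lt_one hl
  param_lt l hl := x.levelParam_lt (by omega)

end Field

/-! ### The measure `dg` and the integral of the distribution function -/

section Intensity

variable {g : ℝ → ℝ}

theorem IsCovFunction.continuousOn_derivWithin (hg : IsCovFunction g) :
    ContinuousOn (derivWithin g (Icc 0 1)) (Icc 0 1) :=
  hg.contDiffOn.continuousOn_derivWithin (uniqueDiffOn_Icc zero_lt_one) le_rfl

theorem IsCovFunction.integral_derivWithin (hg : IsCovFunction g) {a b : ℝ} (ha : 0 ≤ a)
    (hab : a ≤ b) (hb : b ≤ 1) :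
    ∫ r in a..b, derivWithin g (Icc 0 1) r = g b - g a := by
  have hsub : Icc a b ⊆ Icc 0 1 := Icc_subset_Icc ha hb
  refine intervalIntegral.integral_eq_sub_of_hasDerivAt_of_le hab
    (hg.contDiffOn.continuousOn.mono hsub) (fun r hr => ?_)
    ((hg.continuousOn_derivWithin.mono hsub).intervalIntegrable_of_Icc hab)
  have hr01 : r ∈ Icc (0 : ℝ) 1 := hsub (Ioo_subset_Icc_self hr)
  exact ((hg.contDiffOn.differentiableOn one_ne_zero r hr01).hasDerivWithinAt).hasDerivAt
    (Icc_mem_nhds (ha.trans_lt hr.1) (hr.2.trans_le hb))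

theorem dMeasure_Ico (hg : IsCovFunction g) {a b : ℝ} (ha : 0 ≤ a) (hab : a ≤ b) (hb : b ≤ 1) :
    dMeasure g (Ico a b) = ENNReal.ofReal (g b - g a) := by
  have hsub : Icc a b ⊆ Icc 0 1 := Icc_subset_Icc ha hb
  rw [dMeasure, withDensity_apply _ measurableSet_Ico, Measure.restrict_restrict measurableSet_Ico,
    inter_eq_left.2 (Ico_subset_Icc_self.trans hsub), ← hg.integral_derivWithin ha hab hb,
    intervalIntegral.integral_of_le hab, ← integral_Ico_eq_integral_Ioc,
    ofReal_integral_eq_lintegral_ofReal]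
  · exact ((hg.continuousOn_derivWithin.mono hsub).integrableOn_Icc).mono_set Ico_subset_Icc_self
  · exact ae_of_all _ fun r => hg.strictMonoOn.monotoneOn.derivWithin_nonneg

theorem dMeasure_singleton (r : ℝ) : dMeasure g {r} = 0 :=
  withDensity_absolutelyContinuous _ _ (measure_singleton r)

theorem dMeasure_compl_Icc : dMeasure g (Icc 0 1)ᶜ = 0 :=
  withDensity_absolutelyContinuous _ _ (by
    rw [Measure.restrict_apply measurableSet_Icc.compl, compl_inter_self, measure_empty])

theorem ae_mem_Ico_dMeasure : ∀ᵐ r ∂(dMeasure g), r ∈ Ico (0 : ℝ) 1 := by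
  have h1 : ∀ᵐ r ∂(dMeasure g), r ∈ Icc (0 : ℝ) 1 := dMeasure_compl_Icc
  have h2 : ∀ᵐ r ∂(dMeasure g), r ≠ 1 := by
    simp [ae_iff, dMeasure_singleton]
  filter_upwards [h1, h2] with r h1 h2 using ⟨h1.1, lt_of_le_of_ne h1.2 h2⟩

theorem isFiniteMeasure_dMeasure (hg : IsCovFunction g) : IsFiniteMeasure (dMeasure g) := by
  refine ⟨?_⟩
  rw [← measure_eq_measure_of_null_sdiff (subset_univ (Ico (0 : ℝ) 1)) (by
    rw [← compl_eq_univ_sdiff]; exact ae_mem_Ico_dMeasure),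
    dMeasure_Ico hg le_rfl zero_le_one le_rfl]
  exact ENNReal.ofReal_lt_top

end Intensity

namespace AtomicMeasure

variable {k : ℕ} (x : AtomicMeasure k) {g : ℝ → ℝ}

theorem df_eq_of_forall_notMem {a b : ℝ} (hab : a ≤ b) (h : ∀ j, x.q j ∉ Ioc a b) :
    x.df b = x.df a := by
  have := x.isProb
  rw [df, df, cdf_eq_real, cdf_eq_real, measureReal_def, measureReal_def]
  congr 1
  refine (measure_eq_measure_of_null_sdiff (Iic_subset_Iic.2 hab) (measure_mono_null ?_
    x.concentrated)).symm
  rintro r ⟨hr1, hr2⟩ ⟨j, rfl⟩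
  exact h j ⟨not_le.1 hr2, hr1⟩

theorem df_eq_zero {r : ℝ} (hr : r < x.q 0) : x.df r = 0 := by
  have := x.isProb
  rw [df, cdf_eq_real, measureReal_def, measure_mono_null _ x.concentrated, ENNReal.toReal_zero]
  rintro s hs ⟨j, rfl⟩
  exact absurd (hr.trans_le (x.q_strictMono.monotone (Fin.zero_le j))) (not_lt.2 hs)

theorem df_eq_levelParam {l : ℕ} {r : ℝ}
    (hr : r ∈ Ico (x.level (l + 1)) (x.level (l + 1 + 1))) : x.df r = levelParam x l := by
  refine x.df_eq_of_forall_notMem hr.1 fun j hj => ?_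
  rw [← x.level_succ j] at hj
  have h1 : l + 1 < (j : ℕ) + 1 := by
    by_contra hle
    exact absurd (x.level_mono (not_lt.1 hle)) (not_le.2 hj.1)
  exact absurd (hj.2.trans_lt hr.2) (not_lt.2 (x.level_mono h1))

theorem measurable_df : Measurable x.df := (monotone_cdf x.law).measurable

theorem memLp_df (hg : IsCovFunction g) : MemLp x.df 1 (dMeasure g) := by
  have := isFiniteMeasure_dMeasure hg
  refine MemLp.of_bound x.measurable_df.aestronglyMeasurable 1 (ae_of_all _ fun r => ?_)
  rw [Real.norm_of_nonneg (x.df_nonneg r)]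
  exact x.df_le_one r

theorem setIntegral_df_eq_sum (hg : IsCovFunction g) (n : ℕ) :
    ∫ r in Ico 0 (x.level n), x.df r ∂(dMeasure g) =
      ∑ l ∈ Finset.range n, ∫ r in Ico (x.level l) (x.level (l + 1)), x.df r ∂(dMeasure g) := by
  have := isFiniteMeasure_dMeasure hg
  have hint : Integrable x.df (dMeasure g) := (x.memLp_df hg).integrable le_rfl
  induction n with
  | zero => simp [level]
  | succ n ih =>
    rw [Finset.sum_range_succ, ← ih, ← setIntegral_union _ measurableSet_Ico hint.integrableOn
      hint.integrableOn, Ico_union_Ico_eq_Ico (x.level_mem n).1 (x.level_mono n.le_succ)]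
    exact Ico_disjoint_Ico_same

/-- On `[q_l, q_{l+1})` the distribution function is constant, and `dg` has mass equal to the
increment of `g`. Before the first atom it vanishes, so the root variance does not appear and `m_l`
is paired with `v_{l+1}`. -/
theorem integral_df (hg : IsCovFunction g) :
    ∫ r, x.df r ∂(dMeasure g) =
      ∑ l ∈ Finset.range k, levelParam x l * levelVar x g (l + 1) := by
  have h1 : ∫ r, x.df r ∂(dMeasure g) = ∫ r in Ico 0 (x.level (k + 1)), x.df r ∂(dMeasure g) := by
    rw [x.level_last, Measure.restrict_eq_self_of_ae_mem ae_mem_Ico_dMeasure]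
  have h0 : ∫ r in Ico (x.level 0) (x.level (0 + 1)), x.df r ∂(dMeasure g) = 0 := by
    rw [setIntegral_congr_fun (g := fun _ => 0) measurableSet_Ico fun r hr => ?_]
    · simp
    · have h2 := x.level_succ 0
      rw [Fin.val_zero] at h2
      exact x.df_eq_zero (h2 ▸ hr.2)
  rw [h1, x.setIntegral_df_eq_sum hg, Finset.sum_range_succ', h0, add_zero]
  refine Finset.sum_congr rfl fun l _ => ?_
  rw [setIntegral_congr_fun measurableSet_Ico fun r hr =>
    x.df_eq_levelParam hr, setIntegral_const, measureReal_def,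
    dMeasure_Ico hg (x.level_mem _).1 (x.level_mono (Nat.le_succ _)) (x.level_mem _).2,
    smul_eq_mul, mul_comm]
  rfl

end AtomicMeasure

/-! ### From tree sums to the functional -/

theorem summable_and_tsum_of_tsum_ofReal {ι : Type*} {f : ι → ℝ} (hf : ∀ i, 0 ≤ f i)
    {S : ℝ≥0∞} (h : ∑' i, ENNReal.ofReal (f i) = S) (hS : S ≠ ∞) :
    Summable f ∧ ∑' i, f i = S.toReal := by
  have h1 : Summable fun i => (ENNReal.ofReal (f i)).toReal := ENNReal.summable_toReal (h ▸ hS)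
  have h2 : ∀ i, (ENNReal.ofReal (f i)).toReal = f i := fun i => ENNReal.toReal_ofReal (hf i)
  refine ⟨by simpa only [h2] using h1, ?_⟩
  rw [← h, ENNReal.tsum_toReal_eq fun i => ENNReal.ofReal_ne_top]
  simp only [h2]

section

variable {Ω : Type*} [mΩ : MeasurableSpace Ω] {P : Measure Ω} {k : ℕ} {x : AtomicMeasure k}
  {g : ℝ → ℝ} {ζ : Node k → ℕ → Ω → ℝ} {κ : (Fin k → ℕ) × Icc (0 : ℝ) 1 → Ω → ℝ}

omit mΩ in
theorem ofReal_weight {ω : Ω} (hζ : ∀ a j, 0 < ζ a j ω) (α : Fin k → ℕ) :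
    ENNReal.ofReal (weight ζ α ω) =
      ∏ l : Fin k, ENNReal.ofReal (wordRem ζ ((List.ofFn α).take l) (α l) ω) := by
  rw [weight, ENNReal.ofReal_prod_of_nonneg fun l _ => (hζ _ _).le]
  exact Finset.prod_congr rfl fun l _ => by rw [← word_trunc, wordRem_word]

omit mΩ in
theorem tsum_ofReal_weight {ω : Ω} (hζ : ∀ a j, 0 < ζ a j ω) :
    ∑' α, ENNReal.ofReal (weight ζ α ω) =
      treeSum (wordRem ζ) (wordIncrement x κ) 0 k [] ω := by
  rw [← tsum_prod_eq_treeSum]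
  refine tsum_congr fun α => ?_
  simp [ofReal_weight hζ]

omit mΩ in
theorem tsum_ofReal_shiftedWeight (β : ℝ) {ω : Ω} (hζ : ∀ a j, 0 < ζ a j ω)
    (hκ : ∀ α, κ (α, 1) ω = ∑ l : Fin (k + 1), increment x κ (prefixNode α l) ω) :
    ∑' α, ENNReal.ofReal (shiftedWeight (fun η => β * η) ζ κ α ω) =
      rootedSum (wordRem ζ) (wordIncrement x κ) β k [] ω := by
  rw [rootedSum, ← tsum_prod_eq_treeSum, ← ENNReal.tsum_mul_left]
  refine tsum_congr fun α => ?_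
  have hinc : ∀ l : Fin (k + 1), increment x κ (prefixNode α l) ω =
      wordIncrement x κ ((List.ofFn α).take l) ω := fun l => by
    rw [← word_prefixNode, wordIncrement_word]
  have hexp : Real.exp (β * κ (α, 1) ω) = Real.exp (β * wordIncrement x κ [] ω) *
      ∏ i : Fin k, Real.exp (β * wordIncrement x κ ((List.ofFn α).take (i + 1)) ω) := by
    -- The `k + 1` increments split into the root one, common to all leaves, and one for each of the
    -- `k` edges of the branch.
    rw [hκ, Finset.mul_sum, Real.exp_sum, Fin.prod_univ_succ]
    simp [hinc]
  rw [shiftedWeight, ENNReal.ofReal_mul' (Real.exp_pos _).le, ofReal_weight hζ, hexp,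
    ENNReal.ofReal_mul (Real.exp_pos _).le,
    ENNReal.ofReal_prod_of_nonneg fun i _ => (Real.exp_pos _).le, Finset.prod_mul_distrib]
  simp only [List.nil_append]
  ring

namespace IsGREMWithField

variable [IsProbabilityMeasure P]

/-- Almost surely, both sums converge, and the logarithm of their ratio is a difference of
logarithms of tree sums. -/
theorem ae_summable_and_logRatio (hg : IsCovFunction g) (h : IsGREMWithField x g ζ κ P) (β : ℝ) :
    ∀ᵐ ω ∂P, (Summable fun α => weight ζ α ω) ∧
      (Summable fun α => shiftedWeight (fun η => β * η) ζ κ α ω) ∧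
      logRatio (fun η => β * η) ζ κ ω = β * wordIncrement x κ [] ω +
        (Real.log (treeSum (wordRem ζ) (wordIncrement x κ) β k [] ω).toReal -
          Real.log (treeSum (wordRem ζ) (wordIncrement x κ) 0 k [] ω).toReal) := by
  have hT := h.isTreeField
  have hζ : ∀ᵐ ω ∂P, ∀ a j, 0 < ζ a j ω := ae_all_iff.2 fun a => (h.cascade.isREM a).pos
  have hκ : ∀ᵐ ω ∂P, ∀ α, κ (α, 1) ω =
      ∑ l : Fin (k + 1), increment x κ (prefixNode α l) ω :=
    ae_all_iff.2 fun α => h.field.ae_eq_sum_increment hg α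
  filter_upwards [hζ, hκ, hT.ae_treeSum β, hT.ae_treeSum 0] with ω hζ hκ ⟨hS0, hSt⟩ ⟨hT0, hTt⟩
  have hw : ∀ α, 0 ≤ weight ζ α ω := fun α => Finset.prod_nonneg fun l _ => (hζ _ _).le
  have hsw : ∀ α, 0 ≤ shiftedWeight (fun η => β * η) ζ κ α ω := fun α =>
    mul_nonneg (hw α) (Real.exp_pos _).le
  obtain ⟨h1, h1'⟩ := summable_and_tsum_of_tsum_ofReal hw
    (tsum_ofReal_weight (x := x) (κ := κ) hζ) hTt
  obtain ⟨h2, h2'⟩ := summable_and_tsum_of_tsum_ofReal hsw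
    (tsum_ofReal_shiftedWeight β hζ hκ) (ENNReal.mul_ne_top ENNReal.ofReal_ne_top hSt)
  refine ⟨h1, h2, ?_⟩
  have hSp := ENNReal.toReal_pos hS0 hSt
  have hTp := ENNReal.toReal_pos hT0 hTt
  rw [logRatio, total, h1', h2', rootedSum, ENNReal.toReal_mul,
    ENNReal.toReal_ofReal (Real.exp_pos _).le,
    Real.log_div (mul_pos (Real.exp_pos _) hSp).ne' hTp.ne',
    Real.log_mul (Real.exp_pos _).ne' hSp.ne', Real.log_exp]
  ring

theorem integrable_wordIncrement_nil (h : IsGREMWithField x g ζ κ P) :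
    Integrable (wordIncrement x κ []) P ∧ ∫ ω, wordIncrement x κ [] ω ∂P = 0 := by
  have hlaw := h.isTreeField.hasLaw [] (by simp)
  exact ⟨hlaw.hasGaussianLaw.integrable, hlaw.integral_eq.trans integral_id_gaussianReal⟩

theorem integrable_logRatio (hg : IsCovFunction g) (h : IsGREMWithField x g ζ κ P) (β : ℝ) :
    Integrable (logRatio (fun η => β * η) ζ κ) P := by
  have hT := h.isTreeField
  refine ((h.integrable_wordIncrement_nil.1.const_mul β).add
    ((hT.integrable_log_treeSum β).sub (hT.integrable_log_treeSum 0))).congr ?_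
  filter_upwards [h.ae_summable_and_logRatio hg β] with ω hω using hω.2.2.symm

theorem rpcFunctional_eq (hg : IsCovFunction g) (h : IsGREMWithField x g ζ κ P) (β : ℝ) :
    rpcFunctional (fun η => β * η) ζ κ P = β ^ 2 / 2 * ∫ r, x.df r ∂(dMeasure g) := by
  have hT := h.isTreeField
  have hS := hT.integrable_log_treeSum β
  have hS0 := hT.integrable_log_treeSum 0
  have hd : Integrable (fun ω =>
      Real.log (treeSum (wordRem ζ) (wordIncrement x κ) β k [] ω).toReal -
        Real.log (treeSum (wordRem ζ) (wordIncrement x κ) 0 k [] ω).toReal) P := hS.sub hS0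
  rw [rpcFunctional, integral_congr_ae ((h.ae_summable_and_logRatio hg β).mono fun ω hω => hω.2.2),
    integral_add (h.integrable_wordIncrement_nil.1.const_mul β) hd,
    integral_sub hS hS0, integral_const_mul, h.integrable_wordIncrement_nil.2,
    hT.integral_log_treeSum β, x.integral_df hg]
  ring

end IsGREMWithField

end

end RPC

theorem mainTheorem10 (β : ℝ) (ψ : ℝ → ℝ) (hψ : ∀ η, ψ η = β * η)
    (g : ℝ → ℝ) (hg : RPC.IsCovFunction g) :
    ∃ Λ : Lp ℝ 1 (RPC.dMeasure g) →L[ℝ] ℝ,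
      ∀ (k : ℕ) (x : RPC.AtomicMeasure k),
        ∃ hx : MemLp x.df 1 (RPC.dMeasure g),
          ∀ {Ω : Type*} [MeasurableSpace Ω] (P : Measure Ω) [IsProbabilityMeasure P]
            (ζ : RPC.Node k → ℕ → Ω → ℝ) (κ : (Fin k → ℕ) × Icc (0 : ℝ) 1 → Ω → ℝ),
            RPC.IsGREMWithField x g ζ κ P →
              (∀ᵐ ω ∂P, Summable fun α => RPC.weight ζ α ω) ∧
              (∀ᵐ ω ∂P, Summable fun α => RPC.shiftedWeight ψ ζ κ α ω) ∧
              Integrable (RPC.logRatio ψ ζ κ) P ∧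
              RPC.rpcFunctional ψ ζ κ P = β ^ 2 / 2 * ∫ r, x.df r ∂(RPC.dMeasure g) ∧
              RPC.rpcFunctional ψ ζ κ P = Λ (hx.toLp x.df) := by
  obtain rfl : ψ = fun η => β * η := funext hψ
  -- The functional is integration on `L¹(dg)` up to a factor, fixed before `k` and `x` are chosen.
  refine ⟨(β ^ 2 / 2) • L1.integralCLM, fun k x => ⟨x.memLp_df hg, ?_⟩⟩
  intro Ω _ P _ ζ κ h
  have hae := h.ae_summable_and_logRatio hg β
  refine ⟨hae.mono fun ω hω => hω.1, hae.mono fun ω hω => hω.2.1, h.integrable_logRatio hg β,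
    h.rpcFunctional_eq hg β, ?_⟩
  rw [h.rpcFunctional_eq hg β, _root_.smul_apply, smul_eq_mul,
    ← integral_congr_ae (x.memLp_df hg).coeFn_toLp, ← L1.integral_eq_integral, L1.integral_def]
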